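/- **Definitions.** $\Delta X$ denotes the set of (finitely supported) probability distributions on $X$ with rational probabilities. A *minion* $\mathcal M$ is a functor from finite sets to sets: sets $\mathcal M^{(N)}$ and minor maps $\mathcal M^{(\pi)}:\mathcal M^{(N)}\to\mathcal M^{(N')}$ for $\pi:N\to N'$, compatible with identities and compositions; *minion homomorphisms* are families of maps $\xi^{(N)}$ that commute with the minor maps. An $N$-ary *weighting* of $\mathcal M$ is a pair $\Omega=(\Omega^{\mathrm{in}},\Omega^{\mathrm{out}})\in\Delta N\times\Delta\mathcal M^{(N)}$; its *minor* by $\pi:N\to N'$ is $(\pi(\Omega^{\mathrm{in}}),\mathcal M^{(\pi)}(\Omega^{\mathrm{out}}))$. We write $\Omega^{\mathrm{in}}[\alpha]$, $\Omega^{\mathrm{out}}[\beta]$ for expected values. A *valued minion* $\mathbb M$ over $\mathcal M$ assigns to every finite family $(N_j)_{j\in J}$ of finite sets a set $\mathbb M^{((N_j)_j)}$ of families $(\Omega_j)_{j\in J}$ of $N_j$-ary weightings of $\mathcal M$, such that if $(\Omega_j)_{j\in J}$ belongs to it and each $\Omega'_{j'}$, $j'\in J'$, is an $N'_{j'}$-ary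 minor of some $\Omega_j$, then $(\Omega'_{j'})_{j'\in J'}\in\mathbb M^{((N'_{j'})_{j'})}$. It is *nontrivial* if $\mathbb M^{(N)}\neq\emptyset$ for every nonempty finite $N$, and *locally finite* if all $\mathcal M^{(N)}$ are finite. Its *support minion* is $\mathrm{Supp}(\mathbb M)^{(N)}=\bigcup_{\Omega\in\mathbb M^{(N)}}\mathrm{Supp}(\Omega^{\mathrm{out}})$ with the restricted minor maps. A *valued minion homomorphism* $\mathbb M\to\mathbb M'$ is a probability distribution $\Xi$ on the set of minion homomorphisms $\mathrm{Supp}(\mathbb M)\to\mathrm{Supp}(\mathbb M')$ such that $(\Omega_j)_j\in\mathbb M^{((N_j)_j)}$ implies $(\Omega_j^{\mathrm{in}},\Xi(\Omega_j^{\mathrm{out}}))_j\in\mathbb M'^{((N_j)_j)}$, where $\Xi(\mu)$ is the distribution of $\xi(f)$ for independent $\xi\sim\Xi$, $f\sim\mu$. For a nontrivial, locally finite valued minion $\mathbb M$ over $\mathcal M$ and a positive integer $k$, $\mathrm{VMC}(\mathcal M,\mathbb M,k)$ is the following promise problem. *Input:* disjoint finite sets $U,V$ of variables; a domain $D_x$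 with $|D_x|\le k$ for each $x\in U\cup V$; a finite set of minor conditions $\pi(u)=v$ with $u\in U$, $v\in V$, $\pi:D_u\to D_v$; for each $u\in U$ payoff functions $\alpha_u:D_u\to\mathbb Q$ and $\beta_u:\mathcal M^{(D_u)}\to\mathbb Q$ such that for all $(\Omega_u)_{u\in U}\in\mathbb M^{((D_u)_{u\in U})}$ $$\sum_{u}\Omega_u^{\mathrm{in}}[\alpha_u]\ge 0\implies\sum_u\Omega_u^{\mathrm{out}}[\beta_u]\ge 0 .$$ Payoffs are given as tables of fractions in binary (the tables of $\beta_u$ with respect to fixed enumerations of the finite sets $\mathcal M^{([n])}$). *Yes:* there is $h$ with $h(x)\in D_x$, $\pi(h(u))=h(v)$ for every minor condition, and $\sum_u\alpha_u(h(u))\ge 0$. *No:* there is no $h$ with $h(x)\in\mathcal M^{(D_x)}$, $\mathcal M^{(\pi)}(h(u))=h(v)$ for every minor condition, and $\sum_u\beta_u(h(u))\ge 0$. **Proposition (Between VMCs).** Let $\mathbb M,\mathbb M'$ be nontrivial, locally finite valued minions over minions $\mathcal M,\mathcal M'$, respectively, and let $\Xi$ be a valued minion homomorphism $\mathbb M\to\mathbb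 M'$. Then for every positive integer $k$ there is a polynomial-time (many-one) reduction from $\mathrm{VMC}(\mathcal M',\mathbb M',k)$ to $\mathrm{VMC}(\mathcal M,\mathbb M,k)$; that is, $\mathrm{VMC}(\mathcal M',\mathbb M',k)\le\mathrm{VMC}(\mathcal M,\mathbb M,k)$. Moreover, the reduction can be chosen so that every input all of whose domains are nonempty is unchanged except that its output payoff functions $\beta'_u$ are replaced by functions $\beta_u$ with $$\beta_u(f)=\mathbb E_{\xi\sim\Xi}\,\beta'_u(\xi^{(D_u)}(f))\ \text{ for } f\in\mathrm{Supp}(\mathbb M)^{(D_u)},\qquad \beta_u(f)=-P\ \text{ for } f\in\mathcal M^{(D_u)}\setminus\mathrm{Supp}(\mathbb M)^{(D_u)},$$ where $P>0$ is a rational number, depending on the input, with $P>|U|\cdot\beta'_u(g)$ for all $u\in U$ and $g\in\mathcal M'^{(D_u)}$. -/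

import Mathlib

/-! ### Rational probability distributions -/

/-- A probability distribution on `X` with rational probabilities and finite support. -/
structure RatDist (X : Type*) where
  weight : X →₀ ℚ≥0
  total : (weight.sum fun _ q => q) = 1

namespace RatDist

variable {X Y : Type*}

/-- The support of a distribution: the points of positive probability. -/
def supp (μ : RatDist X) : Set X := {x | 0 < μ.weight x}

/-- The expected value of `f x` when `x` is sampled according to `μ`. -/
noncomputable def expect (μ : RatDist X) (f : X → ℚ) : ℚ :=
  μ.weight.sum fun x q => (q : ℚ) * f x

/-- The image distribution `f(μ)`. -/
noncomputable def map (f : X → Y) (μ : RatDist X) : RatDist Y where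
  weight := μ.weight.mapDomain f
  total := by
    rw [Finsupp.sum_mapDomain_index (fun _ => rfl) (fun _ _ _ => rfl)]
    exact μ.total

/-- Sample `x` according to `μ`, then sample from `F x`. -/
noncomputable def bind (μ : RatDist X) (F : X → RatDist Y) : RatDist Y where
  weight := μ.weight.sum fun x q => q • (F x).weight
  total := by
    rw [Finsupp.sum_sum_index (fun _ => rfl) (fun _ _ _ => rfl)]
    refine (Finset.sum_congr rfl fun x _ => ?_).trans μ.total
    change ((μ.weight x • (F x).weight).sum fun _ q => q) = μ.weight x
    rw [Finsupp.sum_smul_index (fun _ => rfl), ← Finsupp.mul_sum, (F x).total, mul_one]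

/-- A distribution whose support lies in `S`, regarded as a distribution on `S`. -/
noncomputable def restrict (μ : RatDist X) (S : Set X) (h : μ.supp ⊆ S) : RatDist S where
  weight := μ.weight.subtypeDomain (fun x => x ∈ S)
  total := by
    rw [Finsupp.sum_subtypeDomain_index (h := fun _ q => q)]
    · exact μ.total
    · intro x hx
      exact h (pos_iff_ne_zero.mpr (Finsupp.mem_support_iff.mp hx))

/-- A point in the support of an image distribution comes from a point in the support. -/
theorem exists_of_mem_supp_map {f : X → Y} {μ : RatDist X} {y : Y} (hy : y ∈ (μ.map f).supp) :
    ∃ x ∈ μ.supp, f x = y := by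
  classical
  have h1 : y ∈ (μ.weight.mapDomain f).support :=
    Finsupp.mem_support_iff.mpr (pos_iff_ne_zero.mp hy)
  obtain ⟨x, hx, rfl⟩ := Finset.mem_image.mp (Finsupp.mapDomain_support h1)
  exact ⟨x, pos_iff_ne_zero.mpr (Finsupp.mem_support_iff.mp hx), rfl⟩

/-- The image of a point in the support lies in the support of the image distribution. -/
theorem mem_supp_map (f : X → Y) {μ : RatDist X} {x : X} (hx : x ∈ μ.supp) :
    f x ∈ (μ.map f).supp := by
  classical
  have h1 : μ.weight x ≤ μ.weight.mapDomain f (f x) := by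
    rw [Finsupp.mapDomain, Finsupp.sum, Finsupp.finsetSum_apply]
    have hm : x ∈ μ.weight.support :=
      Finsupp.mem_support_iff.mpr (pos_iff_ne_zero.mp hx)
    refine le_trans ?_ (Finset.single_le_sum (f := fun a =>
      (Finsupp.single (f a) (μ.weight a)) (f x)) (fun _ _ => zero_le) hm)
    simp
  exact lt_of_lt_of_le hx h1

end RatDist

/-! ### Minions and valued minions -/

/-- An (abstract) minion: a set for every finite set `N` and a minor map for every function
between finite sets, compatible with identities and compositions. -/
structure Minion where
  obj : (N : Type) → [Finite N] → Type
  map : {N N' : Type} → [Finite N] → [Finite N'] → (N → N') → obj N → obj N'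
  map_id : ∀ {N : Type} [Finite N] (f : obj N), map id f = f
  map_comp : ∀ {N₁ N₂ N₃ : Type} [Finite N₁] [Finite N₂] [Finite N₃]
    (π : N₂ → N₃) (ρ : N₁ → N₂) (f : obj N₁), map π (map ρ f) = map (π ∘ ρ) f

/-- A minion is locally finite if all its sets are finite. -/
def Minion.LocallyFinite (M : Minion) : Prop := ∀ (N : Type) [Finite N], Finite (M.obj N)

/-- A minion homomorphism: a family of functions that preserves taking minors. -/
structure MinionHom (M M' : Minion) where
  app : (N : Type) → [Finite N] → M.obj N → M'.obj N
  app_map : ∀ {N N' : Type} [Finite N] [Finite N'] (π : N → N') (f : M.obj N),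
    app N' (M.map π f) = M'.map π (app N f)

/-- An `N`-ary weighting of a minion: a distribution on `N` and a distribution on `M.obj N`. -/
structure Weighting (M : Minion) (N : Type) [Finite N] where
  inn : RatDist N
  out : RatDist (M.obj N)

/-- The minor of a weighting given by `π`. -/
noncomputable def Weighting.minor {M : Minion} {N N' : Type} [Finite N] [Finite N']
    (Ω : Weighting M N) (π : N → N') : Weighting M N' where
  inn := Ω.inn.map π
  out := Ω.out.map (M.map π)

/-- A valued minion over `M`: for every finite family `(N j)` of finite sets a set of families
of weightings, where the whole collection is closed under taking minors. -/
structure ValuedMinion (M : Minion) where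
  fam : {J : Type} → [Finite J] → (N : J → Type) → [∀ j, Finite (N j)] →
    Set ((j : J) → Weighting M (N j))
  closed : ∀ {J J' : Type} [Finite J] [Finite J'] (N : J → Type) [∀ j, Finite (N j)]
    (N' : J' → Type) [∀ j, Finite (N' j)]
    (Ω : (j : J) → Weighting M (N j)) (Ω' : (j : J') → Weighting M (N' j)),
    Ω ∈ fam N → (∀ j' : J', ∃ (j : J) (π : N j → N' j'), Ω' j' = (Ω j).minor π) → Ω' ∈ fam N'

namespace ValuedMinion

variable {M M' : Minion}

/-- The weightings belonging to a single finite set `N` (a family with one member). -/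
def single (V : ValuedMinion M) (N : Type) [Finite N] : Set (Weighting M N) :=
  {Ω | (fun _ : Unit => Ω) ∈ V.fam (fun _ : Unit => N)}

/-- A valued minion is nontrivial if it has an `N`-ary weighting for every nonempty `N`. -/
def Nontrivial (V : ValuedMinion M) : Prop :=
  ∀ (N : Type) [Finite N] [Nonempty N], (V.single N).Nonempty

/-- A valued minion is locally finite if so is the minion it lies over. -/
def LocallyFinite (_V : ValuedMinion M) : Prop := M.LocallyFinite

/-- The elements of `M.obj N` in the support of some `N`-ary weighting of the valued minion. -/
def suppSet (V : ValuedMinion M) (N : Type) [Finite N] : Set (M.obj N) :=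
  {f | ∃ Ω ∈ V.single N, f ∈ Ω.out.supp}

theorem map_mem_suppSet (V : ValuedMinion M) {N N' : Type} [Finite N] [Finite N'] (π : N → N')
    {f : M.obj N} (hf : f ∈ V.suppSet N) : M.map π f ∈ V.suppSet N' := by
  obtain ⟨Ω, hΩ, hfΩ⟩ := hf
  exact ⟨Ω.minor π, V.closed _ _ _ _ hΩ fun _ => ⟨(), π, rfl⟩, RatDist.mem_supp_map _ hfΩ⟩

/-- The support minion, with the minor maps restricted from `M`. -/
def suppMinion (V : ValuedMinion M) : Minion where
  obj N := V.suppSet N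
  map π f := ⟨M.map π f.1, V.map_mem_suppSet π f.2⟩
  map_id f := Subtype.ext (M.map_id f.1)
  map_comp π ρ f := Subtype.ext (M.map_comp π ρ f.1)

/-- The element of `M` underlying an element of the support minion. -/
def suppVal (V : ValuedMinion M) {N : Type} [Finite N] (f : V.suppMinion.obj N) : M.obj N :=
  Subtype.val f

theorem supp_subset_suppSet (V : ValuedMinion M) {J : Type} [Finite J] {N : J → Type}
    [∀ j, Finite (N j)] {Ω : (j : J) → Weighting M (N j)} (hΩ : Ω ∈ V.fam N) (j : J) :
    (Ω j).out.supp ⊆ V.suppSet (N j) := by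
  intro f hf
  refine ⟨(Ω j).minor id, V.closed _ _ Ω _ hΩ fun _ => ⟨j, id, rfl⟩, ?_⟩
  have h := RatDist.mem_supp_map (M.map (id : N j → N j)) hf
  rwa [M.map_id] at h

end ValuedMinion

/-- The weighting `Ξ(Ω) = (Ω^in, Ξ(Ω^out))`, where `Ξ(Ω^out)` is sampled by independently
sampling `ξ` from `Ξ` and `f` from `Ω^out` and then computing `ξ(f)`. -/
noncomputable def applyDist {M M' : Minion} {V : ValuedMinion M} {V' : ValuedMinion M'}
    (Ξ : RatDist (MinionHom V.suppMinion V'.suppMinion)) {N : Type} [Finite N]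
    (Ω : Weighting M N) (h : Ω.out.supp ⊆ V.suppSet N) : Weighting M' N where
  inn := Ω.inn
  out := Ξ.bind fun ξ =>
    (Ω.out.restrict (V.suppSet N) h).map fun f => V'.suppVal (ξ.app N f)

/-- A valued minion homomorphism: a distribution on the minion homomorphisms between the support
minions that maps families in the first valued minion to families in the second one. -/
structure ValuedMinionHom {M M' : Minion} (V : ValuedMinion M) (V' : ValuedMinion M') where
  dist : RatDist (MinionHom V.suppMinion V'.suppMinion)
  preserves : ∀ {J : Type} [Finite J] (N : J → Type) [∀ j, Finite (N j)]
    (Ω : (j : J) → Weighting M (N j)) (hΩ : Ω ∈ V.fam N),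
    (fun j => applyDist dist (Ω j) (V.supp_subset_suppSet hΩ j)) ∈ V'.fam N

/-! ### Promise problems and polynomial-time many-one reductions -/

/-- A promise decision problem: instances (those that satisfy the requirements on the input),
their encoding as words, the `yes` instances and the `no` instances. -/
structure PromiseProblem where
  Instance : Type
  encode : Instance → List Computability.Γ'
  Yes : Instance → Prop
  No : Instance → Prop

/-- `r` is a polynomial-time many-one reduction from `P` to `Q`: it is computed on encodings by a
(multi-stack) Turing machine in polynomial time, and it preserves `yes` and `no` instances. -/
def IsPolyTimeReduction (P Q : PromiseProblem) (r : P.Instance → Q.Instance) : Prop :=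
  Nonempty (Turing.TM2ComputableInPolyTime P.encode Q.encode r) ∧
    (∀ x, P.Yes x → Q.Yes (r x)) ∧ (∀ x, P.No x → Q.No (r x))

/-! ### Encodings -/

/-- A fraction (not necessarily in lowest terms), used to present a rational number. -/
structure Frac where
  num : ℤ
  den : ℕ
  den_pos : 0 < den

/-- The rational number presented by a fraction. -/
def Frac.value (q : Frac) : ℚ := (q.num : ℚ) / (q.den : ℚ)

namespace Enc

open Computability

/-- A natural number in binary, terminated by a comma. -/
def nat (n : ℕ) : List Γ' := (encodeNat n).map Γ'.bit ++ [Γ'.comma]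

/-- A fraction: sign bit of the numerator, its absolute value, the denominator. -/
def frac (q : Frac) : List Γ' :=
  Γ'.bit (decide (q.num < 0)) :: (nat q.num.natAbs ++ nat q.den)

/-- A list between brackets. -/
def list {X : Type} (e : X → List Γ') (l : List X) : List Γ' :=
  Γ'.bra :: (l.flatMap e ++ [Γ'.ket])

end Enc

/-! ### The Valued Minor Condition Problem -/

/-- A formal expression `π(u) = v`, for given domains of the variables. -/
structure MinorCondition {nU nV : ℕ} (domU : Fin nU → ℕ) (domV : Fin nV → ℕ) where
  u : Fin nU
  v : Fin nV
  π : Fin (domU u) → Fin (domV v)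

/-- The part of an input that does not depend on the minion: variables `U = Fin nU` and
`V = Fin nV` (kept apart), domains `Fin (domU u)` and `Fin (domV v)` of size at most `k`, minor
conditions, and the input payoff functions. -/
structure VMCData (k : ℕ) where
  nU : ℕ
  nV : ℕ
  domU : Fin nU → ℕ
  domV : Fin nV → ℕ
  domU_le : ∀ u, domU u ≤ k
  domV_le : ∀ v, domV v ≤ k
  conds : List (MinorCondition domU domV)
  α : (u : Fin nU) → Fin (domU u) → Frac

/-- All domains are nonempty. -/
def VMCData.DomainsNonempty {k : ℕ} (D : VMCData k) : Prop :=
  (∀ u, 0 < D.domU u) ∧ (∀ v, 0 < D.domV v)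

/-- The condition required of the payoff functions: every family of weightings in the valued
minion with nonnegative total expected input payoff has nonnegative total expected output
payoff. -/
def PayoffCondition {M : Minion} (V : ValuedMinion M) {k : ℕ} (D : VMCData k)
    (β : (u : Fin D.nU) → M.obj (Fin (D.domU u)) → Frac) : Prop :=
  ∀ Ω ∈ V.fam (fun u => Fin (D.domU u)),
    0 ≤ ∑ u, (Ω u).inn.expect (fun d => (D.α u d).value) →
    0 ≤ ∑ u, (Ω u).out.expect (fun f => (β u f).value)

/-- An input of the Valued Minor Condition Problem. -/
structure VMCInstance {M : Minion} (V : ValuedMinion M) (k : ℕ) extends VMCData k where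
  β : (u : Fin nU) → M.obj (Fin (domU u)) → Frac
  payoff : PayoffCondition V toVMCData β

namespace VMCInstance

variable {M : Minion} {V : ValuedMinion M} {k : ℕ}

/-- There is an assignment in the domains that satisfies all the minor conditions and has
nonnegative total input payoff. -/
def Yes (I : VMCInstance V k) : Prop :=
  ∃ (hU : (u : Fin I.nU) → Fin (I.domU u)) (hV : (v : Fin I.nV) → Fin (I.domV v)),
    (∀ c ∈ I.conds, c.π (hU c.u) = hV c.v) ∧ 0 ≤ ∑ u, (I.α u (hU u)).value

/-- There is no assignment in the minion that satisfies all the minor conditions and has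
nonnegative total output payoff. -/
def No (I : VMCInstance V k) : Prop :=
  ¬ ∃ (hU : (u : Fin I.nU) → M.obj (Fin (I.domU u)))
      (hV : (v : Fin I.nV) → M.obj (Fin (I.domV v))),
    (∀ c ∈ I.conds, M.map c.π (hU c.u) = hV c.v) ∧ 0 ≤ ∑ u, (I.β u (hU u)).value

end VMCInstance

/-- A choice, for every `n`, of an enumeration of the finite set `M.obj (Fin n)`; it fixes the
order in which the values of an output payoff function are listed. -/
def Minion.Enumeration (M : Minion) : Type :=
  (n : ℕ) → Fin (Nat.card (M.obj (Fin n))) ≃ M.obj (Fin n)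

/-- The word that presents an input: for every `u` the size of its domain and the tables of
`α u` and `β u`; for every `v` the size of its domain; for every minor condition `u`, `v`
and the table of `π`. -/
noncomputable def VMCInstance.encode {M : Minion} {V : ValuedMinion M} {k : ℕ} (e : M.Enumeration)
    (I : VMCInstance V k) : List Computability.Γ' :=
  Enc.list (fun u : Fin I.nU =>
      Enc.nat (I.domU u) ++ Enc.list Enc.frac (List.ofFn (I.α u)) ++
        Enc.list Enc.frac (List.ofFn fun i => I.β u (e (I.domU u) i)))
    (List.finRange I.nU) ++
  Enc.list (fun v : Fin I.nV => Enc.nat (I.domV v)) (List.finRange I.nV) ++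
  Enc.list (fun c : MinorCondition I.domU I.domV =>
      Enc.nat c.u ++ Enc.nat c.v ++
        Enc.list (fun d : Fin (I.domU c.u) => Enc.nat (c.π d)) (List.finRange (I.domU c.u)))
    I.conds

/-- The Valued Minor Condition Problem for `M`, the valued minion `V` over `M`, and `k`. -/
noncomputable def VMC {M : Minion} (V : ValuedMinion M) (k : ℕ) (e : M.Enumeration) : PromiseProblem where
  Instance := VMCInstance V k
  encode := VMCInstance.encode e
  Yes := VMCInstance.Yes
  No := VMCInstance.No

/-- `I` is the input `I'` with its output payoff functions replaced: on the support of `V`, the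
new payoff is the `Ξ`-average of the old payoffs; outside it is `-P` for a large `P > 0`. -/
def ReplacesOutputPayoffs {M M' : Minion} {V : ValuedMinion M} {V' : ValuedMinion M'}
    (Ξ : ValuedMinionHom V V') {k : ℕ} (I' : VMCInstance V' k) (I : VMCInstance V k) : Prop :=
  ∃ (β : (u : Fin I'.nU) → M.obj (Fin (I'.domU u)) → Frac)
    (hβ : PayoffCondition V I'.toVMCData β) (P : ℚ),
    I = { toVMCData := I'.toVMCData, β := β, payoff := hβ } ∧
    0 < P ∧ (∀ u g, (I'.nU : ℚ) * (I'.β u g).value < P) ∧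
    (∀ u f, ∀ hf : f ∈ V.suppSet (Fin (I'.domU u)),
      (β u f).value = Ξ.dist.expect fun ξ =>
        (I'.β u (V'.suppVal (ξ.app (Fin (I'.domU u)) ⟨f, hf⟩))).value) ∧
    (∀ u f, f ∉ V.suppSet (Fin (I'.domU u)) → (β u f).value = -P)

/-!
An input without empty domains is changed only in its output payoffs. The new payoff of `f` is the
`Ξ`-average of the old payoffs of `ξ f` if `f` lies in the support minion, and `-P` otherwise, with
`P = 2 ^ L` for the length `L` of the input word; this is large enough by
`VMCInstance.mul_value_lt`. The condition on the payoff functions survives, because exchanging the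
order of the two averages turns the new output payoff of a family `Ω` into the old output payoff of
`Ξ(Ω)`, and `Ξ` preserves membership (`VMCInstance.payoffCondition_newβ`). An assignment in `M` of
nonnegative new payoff takes all its values for `U` in the support minion: a new payoff is always
less than `P / |U|`, so a single `-P` could not be made up for. Some `ξ` in the support of `Ξ` does
at least as well as the average, and `ξ` maps the assignment to one in `M'` of nonnegative old
payoff (`VMCInstance.no_of_replacesOutputPayoffs`). An input with an empty domain is never a `yes`
input and may be mapped to a fixed `no` input. It cannot be treated as the others, because it may
be a `no` input just for want of elements of arity zero in `M'`, while `M` has such elements.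

For a given size of the domain, the table of new payoffs arises from the table of old ones by a
fixed linear map with nonnegative rational coefficients (`VMCInstance.row`), which does not depend
on the input. Thus a machine has to parse the word, and to compute boundedly long sums of fractions
with fixed coefficients. Such a machine is written as a program in a small structured language with
pushes, pops and loops (`StackProg.Prog`), which compiles to Mathlib's multi-stack machines with the
same number of steps (`StackProg.Runs.stepsTo`, `StackProg.polyTime_of_runs`). The arithmetic is
that of binary numbers on stacks (`StackProg.within_add`, `StackProg.within_mul`,
`StackProg.within_absDiff`); it gives sums of fractions without cancellation
(`StackProg.within_accumulateList`), and finally the whole transformation of words in cubic time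
(`StackProg.within_replaceProg`).
-/

namespace StackProg

open Computability (Γ')

/-! ### A programming language for stack machines -/

/-- The finitely many stacks used by the programs: the input `inp`; the output `out`, built up in
reverse; the state `ctl` of the current loop; the mark `flag` for empty domains; the unary length
`pow` of the input; the text `tab` of a payoff table and a copy `tab'` to be consumed; the numbers
`pos`, `neg`, `den` of a partial sum, a fraction `numr`, `denr` to be added, a constant `con`; and
auxiliary stacks. -/
inductive Stack
  | inp | out | ctl | flag | pow | tab | tab' | pos | neg | den | numr | denr | con
  | tmp₁ | tmp₂ | tmp₃
  deriving DecidableEq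

instance : Fintype Stack :=
  .ofList [.inp, .out, .ctl, .flag, .pow, .tab, .tab', .pos, .neg, .den, .numr, .denr, .con,
    .tmp₁, .tmp₂, .tmp₃] (by rintro ⟨⟩ <;> decide)

/-- Contents of all the stacks; the head of a list is the top of the stack. -/
abbrev Store := Stack → List Γ'

/-- A small structured programming language for stack machines; a stack symbol is popped together
with a case distinction, so that programs need no variables. The command `pop k f` pops `k` and
continues with `f` of the popped symbol (`none` if `k` is empty); the command `loop k f` pops `k`
and stops if `k` is empty, and otherwise runs `f` of the popped symbol and starts again. -/
inductive Prog
  | skip : Prog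
  | push : Stack → Γ' → Prog
  | pop : Stack → (Option Γ' → Prog) → Prog
  | seq : Prog → Prog → Prog
  | loop : Stack → (Γ' → Prog) → Prog

open Prog Function

/-- `Runs p s s' t`: from the store `s` the program `p` terminates in the store `s'` after `t`
machine steps. -/
inductive Runs : Prog → Store → Store → ℕ → Prop
  | skip (s) : Runs skip s s 1
  | push (k a s) : Runs (push k a) s (update s k (a :: s k)) 1
  | pop {k f s s' t} : Runs (f (s k).head?) (update s k (s k).tail) s' t →
      Runs (pop k f) s s' (t + 1)
  | seq {p q s s₁ s₂ t₁ t₂} : Runs p s s₁ t₁ → Runs q s₁ s₂ t₂ → Runs (seq p q) s s₂ (t₁ + t₂)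
  | loop_nil {k f s} : s k = [] → Runs (loop k f) s s 1
  | loop_cons {k f s s₁ s₂ a l t₁ t₂} : s k = a :: l → Runs (f a) (update s k l) s₁ t₁ →
      Runs (loop k f) s₁ s₂ t₂ → Runs (loop k f) s s₂ (t₁ + t₂ + 1)

/-! ### Compilation to Turing machines -/

/-- The labels of the machine code of a program. For `pop` and `loop` the label `none` is that of
the test, and there is a copy of the labels of the continuation for every popped symbol. -/
def Lbl : Prog → Type
  | .skip => Unit
  | .push _ _ => Unit
  | .pop _ f => Option (Σ a, Lbl (f a))
  | .seq p q => Lbl p ⊕ Lbl q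
  | .loop _ f => Option (Σ a, Lbl (f a))

instance finite_lbl : (p : Prog) → Finite (Lbl p)
  | .skip => inferInstanceAs (Finite Unit)
  | .push _ _ => inferInstanceAs (Finite Unit)
  | .pop _ f =>
    have := fun a => finite_lbl (f a)
    inferInstanceAs (Finite (Option (Σ a, Lbl (f a))))
  | .seq p q =>
    have := finite_lbl p
    have := finite_lbl q
    inferInstanceAs (Finite (Lbl p ⊕ Lbl q))
  | .loop _ f =>
    have := fun a => finite_lbl (f a)
    inferInstanceAs (Finite (Option (Σ a, Lbl (f a))))

/-- The label at which the machine code of a program starts. -/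
def entry : (p : Prog) → Lbl p
  | .skip => ()
  | .push _ _ => ()
  | .pop _ _ => none
  | .seq p _ => .inl (entry p)
  | .loop _ _ => none

/-- Statements of the machine. Its internal state holds the symbol popped last. -/
abbrev Code (Λ : Type) := Turing.TM2.Stmt (fun _ : Stack => Γ') Λ (Option Γ')

/-- The machine code of a program as a part of a machine with labels `Λ`: its labels are placed by
`emb`, and it leaves by jumping to `ex`. -/
def code {Λ : Type} : (p : Prog) → (Lbl p → Λ) → Λ → Lbl p → Code Λ
  | .skip, _, ex, _ => .goto fun _ => ex
  | .push k a, _, ex, _ => .push k (fun _ => a) (.goto fun _ => ex)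
  | .pop k f, emb, _, none =>
    .pop k (fun _ a => a) (.goto fun a => emb (some ⟨a, entry (f a)⟩))
  | .pop _ f, emb, ex, some ⟨a, l⟩ => code (f a) (fun l => emb (some ⟨a, l⟩)) ex l
  | .seq p q, emb, _, .inl l => code p (fun l => emb (.inl l)) (emb (.inr (entry q))) l
  | .seq _ q, emb, ex, .inr l => code q (fun l => emb (.inr l)) ex l
  | .loop k f, emb, ex, none =>
    .pop k (fun _ a => a) (.goto fun a => match a with
      | none => ex
      | some a => emb (some ⟨a, entry (f a)⟩))
  | .loop _ f, emb, _, some ⟨a, l⟩ =>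
    code (f a) (fun l => emb (some ⟨a, l⟩)) (emb none) l

/-- The machine takes the configuration `c` to `c'` in exactly `t` steps. -/
def StepsTo {Λ : Type} (m : Λ → Code Λ) (t : ℕ)
    (c c' : Turing.TM2.Cfg (fun _ : Stack => Γ') Λ (Option Γ')) : Prop :=
  (flip bind (Turing.TM2.step m))^[t] (some c) = some c'

theorem StepsTo.trans {Λ : Type} {m : Λ → Code Λ} {t₁ t₂ : ℕ} {c₁ c₂ c₃}
    (h₁ : StepsTo m t₁ c₁ c₂) (h₂ : StepsTo m t₂ c₂ c₃) : StepsTo m (t₁ + t₂) c₁ c₃ := by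
  unfold StepsTo at *
  rw [add_comm, iterate_add_apply, h₁, h₂]

theorem StepsTo.single {Λ : Type} {m : Λ → Code Λ} {c c'} (h : Turing.TM2.step m c = some c') :
    StepsTo m 1 c c' := h

/-- The machine code of a program does what the program does, and in the same time. -/
theorem Runs.stepsTo {Λ : Type} {m : Λ → Code Λ} {p : Prog} {s s' : Store} {t : ℕ}
    (h : Runs p s s' t) : ∀ (emb : Lbl p → Λ) (ex : Λ), (∀ l, m (emb l) = code p emb ex l) →
      ∀ v, ∃ v', StepsTo m t ⟨some (emb (entry p)), v, s⟩ ⟨some ex, v', s'⟩ := by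
  induction h with
  | skip s =>
    intro emb ex hm v
    exact ⟨v, .single (by simp [hm, code])⟩
  | push k a s =>
    intro emb ex hm v
    exact ⟨v, .single (by simp [hm, code])⟩
  | @pop k f s s' t h ih =>
    intro emb ex hm v
    obtain ⟨v', hv'⟩ := ih (fun l => emb (some ⟨_, l⟩)) ex (fun l => (hm _).trans rfl) (s k).head?
    refine ⟨v', ?_⟩
    rw [add_comm]
    exact .trans (.single (congrArg (fun c => some (Turing.TM2.stepAux c v s)) (hm none))) hv'
  | @seq p q s s₁ s₂ t₁ t₂ h₁ h₂ ih₁ ih₂ =>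
    intro emb ex hm v
    obtain ⟨v₁, hv₁⟩ := ih₁ (fun l => emb (.inl l)) (emb (.inr (entry q)))
      (fun l => (hm _).trans rfl) v
    obtain ⟨v₂, hv₂⟩ := ih₂ (fun l => emb (.inr l)) ex (fun l => (hm _).trans rfl) v₁
    exact ⟨v₂, hv₁.trans hv₂⟩
  | @loop_nil k f s hk =>
    intro emb ex hm v
    refine ⟨none, .single ?_⟩
    have : update s k [] = s := by rw [← hk, update_eq_self]
    refine (congrArg (fun c => some (Turing.TM2.stepAux c v s)) (hm none)).trans ?_
    simp [code, hk, this]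
  | @loop_cons k f s s₁ s₂ a l t₁ t₂ hk h₁ h₂ ih₁ ih₂ =>
    intro emb ex hm v
    obtain ⟨v₁, hv₁⟩ := ih₁ (fun l => emb (some ⟨_, l⟩)) (emb none) (fun l => (hm _).trans rfl)
      (some a)
    obtain ⟨v₂, hv₂⟩ := ih₂ emb ex hm v₁
    refine ⟨v₂, ?_⟩
    rw [add_comm]
    refine .trans (.single ?_) (hv₁.trans hv₂)
    refine (congrArg (fun c => some (Turing.TM2.stepAux c v s)) (hm none)).trans ?_
    simp [code, hk]

/-- The Turing machine that runs a program, with input and output on the stack `inp`. The label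
`none` is that of the exit; the statement there resets the internal state, as a halting
configuration has to have the initial state. -/
noncomputable def machine (p : Prog) : Turing.FinTM2 where
  K := Stack
  k₀ := .inp
  k₁ := .inp
  Γ _ := Γ'
  Λ := Option (Lbl p)
  main := some (entry p)
  ΛFin := Fintype.ofFinite _
  σ := Option Γ'
  initialState := none
  Γk₀Fin := inferInstanceAs (Fintype Γ')
  m
    | none => .load (fun _ => none) .halt
    | some l => code p some none l

/-- The store with the word `w` on the stack `inp` and nothing else. -/
def wordStore (w : List Γ') : Store := update (fun _ => []) .inp w

/-- A program that turns the encoding of every `x` into that of `f x`, within a time bounded by a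
polynomial in the length of the word, yields a polynomial-time Turing machine for `f`. -/
theorem polyTime_of_runs {α β : Type} {ea : α → List Γ'} {eb : β → List Γ'} {f : α → β}
    (p : Prog) (time : Polynomial ℕ)
    (h : ∀ a, ∃ t, t ≤ time.eval (ea a).length ∧
      Runs p (wordStore (ea a)) (wordStore (eb (f a))) t) :
    Nonempty (Turing.TM2ComputableInPolyTime ea eb f) := by
  refine ⟨{ tm := machine p, inputAlphabet := Equiv.refl _, outputAlphabet := Equiv.refl _,
            time := time + 1, outputsFun := fun a => ?_ }⟩
  -- the words of a computation are given as images under the identity of the alphabet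
  have key : ∀ w w' : List Γ', w = ea a → w' = eb (f a) →
      ∃ t, t ≤ (time + 1).eval (ea a).length ∧
        (flip bind (machine p).step)^[t] (some (Turing.initList (machine p) w)) =
          some (Turing.haltList (machine p) w') := by
    rintro _ _ rfl rfl
    obtain ⟨t, ht, hr⟩ := h a
    obtain ⟨v, hv⟩ := hr.stepsTo (m := (machine p).m) some none (fun l => rfl) none
    refine ⟨t + 1, by simpa using ht, ?_⟩
    have h0 : Turing.initList (machine p) (ea a) =
        ⟨some (some (entry p)), none, wordStore (ea a)⟩ := by
      unfold Turing.initList wordStore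
      congr 1
      funext k
      cases k <;> rfl
    have h1 : Turing.haltList (machine p) (eb (f a)) = ⟨none, none, wordStore (eb (f a))⟩ := by
      unfold Turing.haltList wordStore
      congr 1
      funext k
      cases k <;> rfl
    rw [h0, h1]
    exact hv.trans (.single rfl)
  have key' := key _ _ (List.map_id (ea a)) (List.map_id (eb (f a)))
  exact ⟨⟨key'.choose, key'.choose_spec.2⟩, key'.choose_spec.1⟩

/-! ### Time bounds for programs -/

open Stack

/-- `Within p s s' T`: from the store `s` the program `p` terminates in the store `s'` after at
most `T` machine steps. -/
def Within (p : Prog) (s s' : Store) (T : ℕ) : Prop := ∃ t ≤ T, Runs p s s' t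

theorem Within.congr {p : Prog} {s s' s'' : Store} {T T' : ℕ} (h : Within p s s' T)
    (hs : s' = s'') (hT : T ≤ T') : Within p s s'' T' := by
  obtain ⟨t, ht, hr⟩ := h
  exact ⟨t, ht.trans hT, hs ▸ hr⟩

theorem Within.of_eq {p : Prog} {s₀ s s' : Store} {T : ℕ} (h : Within p s₀ s' T) (hs : s = s₀) :
    Within p s s' T := hs ▸ h

theorem Within.seq {p q : Prog} {s s₁ s₂ : Store} {T₁ T₂ : ℕ} (h₁ : Within p s s₁ T₁)
    (h₂ : Within q s₁ s₂ T₂) : Within (seq p q) s s₂ (T₁ + T₂) := by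
  obtain ⟨t₁, ht₁, hr₁⟩ := h₁
  obtain ⟨t₂, ht₂, hr₂⟩ := h₂
  exact ⟨_, add_le_add ht₁ ht₂, hr₁.seq hr₂⟩

theorem Within.skip (s : Store) : Within skip s s 1 := ⟨1, le_rfl, .skip s⟩

theorem Within.push (k : Stack) (a : Γ') (s : Store) :
    Within (push k a) s (update s k (a :: s k)) 1 := ⟨1, le_rfl, .push k a s⟩

theorem Within.pop_cons {k : Stack} {f : Option Γ' → Prog} {s s' : Store} {T : ℕ} {a : Γ'}
    {l : List Γ'} (hk : s k = a :: l) (h : Within (f (some a)) (update s k l) s' T) :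
    Within (pop k f) s s' (T + 1) := by
  obtain ⟨t, ht, hr⟩ := h
  refine ⟨t + 1, by lia, .pop ?_⟩
  rwa [hk]

theorem Within.pop_nil {k : Stack} {f : Option Γ' → Prog} {s s' : Store} {T : ℕ}
    (hk : s k = []) (h : Within (f none) s s' T) : Within (pop k f) s s' (T + 1) := by
  obtain ⟨t, ht, hr⟩ := h
  have hs : update s k [] = s := by rw [← hk, update_eq_self]
  exact ⟨t + 1, by lia, .pop (by rwa [hk, List.tail_nil, hs])⟩

theorem Within.loop_nil {k : Stack} {f : Γ' → Prog} {s : Store} (hk : s k = []) :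
    Within (loop k f) s s 1 := ⟨1, le_rfl, .loop_nil hk⟩

theorem Within.loop_cons {k : Stack} {f : Γ' → Prog} {s s₁ s₂ : Store} {T₁ T₂ : ℕ} {a : Γ'}
    {l : List Γ'} (hk : s k = a :: l) (h₁ : Within (f a) (update s k l) s₁ T₁)
    (h₂ : Within (loop k f) s₁ s₂ T₂) : Within (loop k f) s s₂ (T₁ + T₂ + 1) := by
  obtain ⟨t₁, ht₁, hr₁⟩ := h₁
  obtain ⟨t₂, ht₂, hr₂⟩ := h₂
  exact ⟨_, by lia, hr₁.loop_cons hk hr₂⟩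

/-! ### Binary numbers on a stack -/

/-- A natural number in binary as the contents of a stack, the lowest bit on top. -/
def nb (n : ℕ) : List Γ' := (Computability.encodeNat n).map Γ'.bit

@[simp] theorem nb_zero : nb 0 = [] := rfl

@[simp] theorem nb_one : nb 1 = [.bit true] := rfl

theorem encodePosNum_eq_bits (p : PosNum) : Computability.encodePosNum p = Nat.bits (p : ℕ) := by
  induction p with
  | one => simp [Computability.encodePosNum]
  | bit0 p ih =>
    rw [Computability.encodePosNum, PosNum.cast_bit0, ← two_mul, ih,
      Nat.bit0_bits _ (PosNum.cast_pos (α := ℕ) p).ne']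
  | bit1 p ih =>
    rw [Computability.encodePosNum, PosNum.cast_bit1, ← two_mul, ih, Nat.bit1_bits]

theorem encodeNat_eq_bits (n : ℕ) : Computability.encodeNat n = Nat.bits n := by
  unfold Computability.encodeNat
  conv_rhs => rw [← Num.to_of_nat n]
  cases (n : Num) with
  | zero => simp [Computability.encodeNum]
  | pos p => exact encodePosNum_eq_bits p

/-- The lowest bit and the remaining bits of a number. -/
theorem nb_of_ne_zero {n : ℕ} (hn : n ≠ 0) : nb n = .bit (n % 2 == 1) :: nb (n / 2) := by
  obtain ⟨m, rfl | rfl⟩ := n.even_or_odd'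
  · have hm : m ≠ 0 := by lia
    simp [nb, encodeNat_eq_bits, Nat.bit0_bits _ hm]
  · have : (2 * m + 1) / 2 = m := by lia
    simp [nb, encodeNat_eq_bits, this]

theorem nb_bit (b : Bool) {n : ℕ} (h : b = true ∨ n ≠ 0) :
    nb (2 * n + b.toNat) = .bit b :: nb n := by
  rw [nb_of_ne_zero (by cases b <;> simp_all)]
  cases b
  · simp
  · have : (2 * n + 1) / 2 = n := by lia
    simp [this]

theorem length_nb_le {n N : ℕ} (h : n < 2 ^ N) : (nb n).length ≤ N := by
  rw [nb, List.length_map, encodeNat_eq_bits, Nat.size_eq_bits_len]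
  exact Nat.size_le.mpr h

theorem lt_two_pow_length_nb (n : ℕ) : n < 2 ^ (nb n).length := by
  rw [nb, List.length_map, encodeNat_eq_bits, Nat.size_eq_bits_len]
  exact Nat.lt_size_self n

theorem nb_two_pow (n : ℕ) : nb (2 ^ n) = List.replicate n (.bit false) ++ [.bit true] := by
  induction n with
  | zero => rfl
  | succ n ih =>
    have := nb_bit false (n := 2 ^ n) (.inr (by positivity))
    rw [pow_succ', List.replicate_succ, List.cons_append, ← ih, ← this]
    simp

/-- The highest bit of a number is set. -/
theorem exists_nb_eq_append (n : ℕ) (hn : n ≠ 0) : ∃ l, nb n = l ++ [.bit true] := by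
  induction n using Nat.strong_induction_on with
  | _ n ih =>
    by_cases h : n / 2 = 0
    · have : n = 1 := by lia
      exact ⟨[], by simp [this]⟩
    · obtain ⟨l, hl⟩ := ih (n / 2) (by lia) h
      exact ⟨_ :: l, by rw [nb_of_ne_zero hn, hl, List.cons_append]⟩

/-! ### Moving and clearing stacks -/

/-- Move the contents of `k` onto `l`, which reverses them. -/
def move (k l : Stack) : Prog := loop k fun a => push l a

theorem within_move {k l : Stack} (hkl : k ≠ l) (s : Store) :
    Within (move k l) s (update (update s l ((s k).reverse ++ s l)) k [])
      (2 * (s k).length + 1) := by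
  generalize hw : s k = w
  induction w generalizing s with
  | nil =>
    refine (Within.loop_nil hw).congr ?_ (by simp)
    funext j
    simp only [update_apply]
    grind
  | cons a w ih =>
    refine (Within.loop_cons hw (.push _ _ _) (ih _ (by simp [hkl]))).congr ?_ ?_
    · funext j
      simp only [update_apply]
      grind
    · simp; lia

/-- Empty the stack `k`. -/
def clear (k : Stack) : Prog := loop k fun _ => skip

theorem within_clear (k : Stack) (s : Store) :
    Within (clear k) s (update s k []) (2 * (s k).length + 1) := by
  generalize hw : s k = w
  induction w generalizing s with
  | nil => exact (Within.loop_nil hw).congr (by simp [← hw]) (by simp)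
  | cons a w ih =>
    exact (Within.loop_cons hw (.skip _) (ih _ (by simp))).congr (by simp) (by simp; lia)

/-- Put the fixed word `w` onto the stack `k`. -/
def load (k : Stack) : List Γ' → Prog
  | [] => skip
  | a :: w => seq (load k w) (push k a)

theorem within_load (k : Stack) (w : List Γ') (s : Store) :
    Within (load k w) s (update s k (w ++ s k)) (w.length + 1) := by
  induction w with
  | nil => exact (Within.skip s).congr (by simp) (by simp)
  | cons a w ih => exact (ih.seq (.push _ _ _)).congr (by simp) (by simp)

/-! ### Addition and multiplication -/

/-- A stack that does not serve as an auxiliary stack of the arithmetic programs. -/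
def IsReg (k : Stack) : Prop := k ≠ ctl ∧ k ≠ tmp₁ ∧ k ≠ tmp₂ ∧ k ≠ tmp₃

instance (k : Stack) : Decidable (IsReg k) := by unfold IsReg; infer_instance

/-- The auxiliary stacks used by an addition are empty. The stack `tmp₃` is left out, since it holds
the bits of a factor while a multiplication performs additions. -/
def Clean (s : Store) : Prop := s ctl = [] ∧ s tmp₁ = [] ∧ s tmp₂ = []

theorem Clean.update {s : Store} (h : Clean s) {k : Stack} (hk : IsReg k) (w : List Γ') :
    Clean (update s k w) := by
  obtain ⟨h1, h2, h3, -⟩ := hk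
  simpa [Clean, h1.symm, h2.symm, h3.symm] using h

/-- The bit shown by the popped symbol; a number is continued by zeros. -/
def digit : Option Γ' → Bool
  | some (.bit b) => b
  | _ => false

/-- Put a popped symbol onto another stack. -/
def keep (k : Stack) : Option Γ' → Prog
  | none => skip
  | some a => push k a

theorem within_keep (k : Stack) (o : Option Γ') (s : Store) :
    Within (keep k o) s (update s k (o.toList ++ s k)) 1 := by
  cases o with
  | none => exact (Within.skip s).congr (by simp) le_rfl
  | some a => exact Within.push _ _ _

/-- One digit of an addition with carry `c`: the digit of the sum goes onto `tmp₁`, the digit of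
the second summand is kept on `tmp₂`. Once both numbers are exhausted and there is no carry, nothing
is put onto `ctl`, which ends the loop; hence the sum has no leading zeros. -/
def addDigit (c : Γ') (a b : Option Γ') : Prog :=
  match a, b, c with
  | none, none, .bit false => skip
  | a, b, c =>
    seq (push tmp₁ (.bit ((digit a ^^ digit b) ^^ digit (some c))))
      (seq (keep tmp₂ b)
        (push ctl (.bit (digit a && digit b || digit a && digit (some c) ||
          digit b && digit (some c)))))

/-- The addition loop; the stack `ctl` holds the carry. -/
def addLoop (x y : Stack) : Prog := loop ctl fun c => pop x fun a => pop y fun b => addDigit c a b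

theorem within_pop_nb {k : Stack} {f : Option Γ' → Prog} {s s' : Store} {T n : ℕ}
    (hk : s k = nb n)
    (h : Within (f (nb n).head?) (update s k (nb (n / 2))) s' T) :
    Within (pop k f) s s' (T + 1) := by
  by_cases hn : n = 0
  · subst hn
    refine .pop_nil hk ?_
    have hs : update s k (nb (0 / 2)) = s := by
      rw [Nat.zero_div, ← hk, update_eq_self]
    rwa [hs] at h
  · rw [nb_of_ne_zero hn] at hk h
    exact .pop_cons hk h

theorem digit_head?_nb (n : ℕ) : digit (nb n).head? = (n % 2 == 1) := by
  by_cases hn : n = 0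
  · subst hn; rfl
  · rw [nb_of_ne_zero hn]; rfl

theorem head?_nb_eq_none {n : ℕ} : (nb n).head? = none ↔ n = 0 := by
  by_cases hn : n = 0
  · simp [hn]
  · simp [nb_of_ne_zero hn, hn]

theorem toList_head?_append_nb (n : ℕ) : (nb n).head?.toList ++ nb (n / 2) = nb n := by
  by_cases hn : n = 0
  · simp [hn]
  · simp [nb_of_ne_zero hn]

theorem reverse_nb_half_append (n : ℕ) (w : List Γ') :
    (nb (n / 2)).reverse ++ ((nb n).head?.toList ++ w) = (nb n).reverse ++ w := by
  conv_rhs => rw [← toList_head?_append_nb n]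
  cases (nb n).head? <;> simp

theorem addDigit_of_ne {c : Bool} {x y : ℕ} (h : x + y + c.toNat ≠ 0) :
    addDigit (.bit c) (nb x).head? (nb y).head? =
      seq (push tmp₁ (.bit ((x + y + c.toNat) % 2 == 1)))
        (seq (keep tmp₂ (nb y).head?)
          (push ctl (.bit (decide (2 ≤ x % 2 + y % 2 + c.toNat))))) := by
  have e1 : ((digit (nb x).head? ^^ digit (nb y).head?) ^^ digit (some (.bit c))) =
      ((x + y + c.toNat) % 2 == 1) := by
    rw [digit_head?_nb, digit_head?_nb]
    rcases Nat.mod_two_eq_zero_or_one x with hx | hx <;>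
      rcases Nat.mod_two_eq_zero_or_one y with hy | hy <;> cases c <;>
        simp [Nat.add_mod, hx, hy, digit]
  have e2 : (digit (nb x).head? && digit (nb y).head? ||
      digit (nb x).head? && digit (some (.bit c)) ||
      digit (nb y).head? && digit (some (.bit c))) =
      decide (2 ≤ x % 2 + y % 2 + c.toNat) := by
    rw [digit_head?_nb, digit_head?_nb]
    rcases Nat.mod_two_eq_zero_or_one x with hx | hx <;>
      rcases Nat.mod_two_eq_zero_or_one y with hy | hy <;> cases c <;>
        simp [hx, hy, digit]
  rw [← e1, ← e2]
  have hx := head?_nb_eq_none (n := x)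
  have hy := head?_nb_eq_none (n := y)
  unfold addDigit
  split <;> simp_all

theorem within_addLoop_zero {x y : Stack} (hx : IsReg x) (hy : IsReg y) {s : Store}
    (hsx : s x = []) (hsy : s y = []) (hc : s ctl = [.bit false]) :
    Within (addLoop x y) s (update s ctl []) 5 :=
  Within.loop_cons hc (.pop_nil (by simp [hx.1, hsx]) (.pop_nil (by simp [hy.1, hsy])
    (.skip _))) (.loop_nil (by simp))

theorem within_addLoop_step {x y : Stack} (hxy : x ≠ y) (hx : IsReg x) (hy : IsReg y)
    {a b : ℕ} {c : Bool} {s s' : Store} {T : ℕ} (hsx : s x = nb a) (hsy : s y = nb b)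
    (hc : s ctl = [.bit c]) (h : a + b + c.toNat ≠ 0)
    (H : Within (addLoop x y)
      (update (update (update (update (update s x (nb (a / 2))) y (nb (b / 2)))
        tmp₁ (.bit ((a + b + c.toNat) % 2 == 1) :: s tmp₁))
        tmp₂ ((nb b).head?.toList ++ s tmp₂))
        ctl [.bit (decide (2 ≤ a % 2 + b % 2 + c.toNat))]) s' T) :
    Within (addLoop x y) s s' (T + 6) := by
  obtain ⟨hx1, hx2, hx3, -⟩ := hx
  obtain ⟨hy1, hy2, hy3, -⟩ := hy
  refine (Within.loop_cons hc (within_pop_nb (n := a) (by simp [hx1, hsx])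
    (within_pop_nb (n := b) (T := 3) (by simp [hy1, hsy, hxy.symm]) ?_)) H).congr rfl (by lia)
  rw [addDigit_of_ne h]
  refine (Within.seq (.push _ _ _) (.seq (within_keep _ _ _) (.push _ _ _))).congr ?_ le_rfl
  funext j
  simp only [update_apply]
  grind

theorem within_addLoop {x y : Stack} (hxy : x ≠ y) (hx : IsReg x) (hy : IsReg y) (N : ℕ) :
    ∀ (a b : ℕ) (c : Bool) (s : Store), a < 2 ^ N → b < 2 ^ N → s x = nb a → s y = nb b →
      s ctl = [.bit c] →
      Within (addLoop x y) s
        (update (update (update (update (update s tmp₁ ((nb (a + b + c.toNat)).reverse ++ s tmp₁))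
          tmp₂ ((nb b).reverse ++ s tmp₂)) x []) y []) ctl []) (6 * N + 11) := by
  have hx' := hx
  have hy' := hy
  obtain ⟨hx1, hx2, hx3, -⟩ := hx'
  obtain ⟨hy1, hy2, hy3, -⟩ := hy'
  induction N with
  | zero =>
    intro a b c s ha hb hsa hsb hc
    obtain rfl : a = 0 := by simpa using ha
    obtain rfl : b = 0 := by simpa using hb
    cases c
    · refine (within_addLoop_zero hx hy hsa hsb hc).congr ?_ (by lia)
      funext j
      simp only [update_apply]
      grind [nb_zero]
    · refine (within_addLoop_step hxy hx hy hsa hsb hc (by simp)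
        (within_addLoop_zero hx hy ?_ ?_ ?_)).congr ?_ (by lia)
      · simp [update_apply]; grind
      · simp [update_apply]; grind
      · simp
      funext j
      simp [update_apply]
      grind
  | succ N ih =>
    intro a b c s ha hb hsa hsb hc
    by_cases h0 : a + b + c.toNat = 0
    · obtain ⟨rfl, rfl, rfl⟩ : a = 0 ∧ b = 0 ∧ c = false := by
        cases c <;> simp_all
      refine (within_addLoop_zero hx hy hsa hsb hc).congr ?_ (by lia)
      funext j
      simp only [update_apply]
      grind [nb_zero]
    · refine (within_addLoop_step hxy hx hy hsa hsb hc h0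
        (ih (a / 2) (b / 2) (decide (2 ≤ a % 2 + b % 2 + c.toNat)) _ ?_ ?_ ?_ ?_ ?_)).congr ?_
        (by lia)
      · lia
      · lia
      · simp only [update_apply]; grind
      · simp only [update_apply]; grind
      · simp
      have hsum : a / 2 + b / 2 + (decide (2 ≤ a % 2 + b % 2 + c.toNat)).toNat =
          (a + b + c.toNat) / 2 := by
        have := Bool.toNat_le c
        by_cases h : 2 ≤ a % 2 + b % 2 + c.toNat <;> simp [h] <;> lia
      rw [hsum]
      have e1 : (nb (a + b + c.toNat)).reverse =
          (nb ((a + b + c.toNat) / 2)).reverse ++ [.bit ((a + b + c.toNat) % 2 == 1)] := by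
        rw [nb_of_ne_zero h0, List.reverse_cons]
      have e2 := reverse_nb_half_append b (s tmp₂)
      rw [e1, ← e2]
      funext j
      simp only [update_apply]
      grind

/-- Add the number on `y` to the number on `x`. -/
def add (x y : Stack) : Prog :=
  seq (push ctl (.bit false)) (seq (addLoop x y) (seq (move tmp₁ x) (move tmp₂ y)))

theorem within_add {x y : Stack} (hxy : x ≠ y) (hx : IsReg x) (hy : IsReg y) {a b N : ℕ}
    {s : Store} (hs : Clean s) (ha : a < 2 ^ N) (hb : b < 2 ^ N) (hsa : s x = nb a)
    (hsb : s y = nb b) : Within (add x y) s (update s x (nb (a + b))) (10 * N + 16) := by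
  have hx' := hx
  have hy' := hy
  obtain ⟨hx1, hx2, hx3, -⟩ := hx'
  obtain ⟨hy1, hy2, hy3, -⟩ := hy'
  obtain ⟨h1, h2, h3⟩ := hs
  refine (Within.seq (.push _ _ _) (.seq (within_addLoop hxy hx hy N a b false _ ha hb ?_ ?_ ?_)
    (.seq (within_move hx2.symm _) (within_move hy3.symm _)))).congr ?_ ?_
  · simp [hx1, hsa]
  · simp [hy1, hsb]
  · simp [h1]
  · funext j
    simp only [update_apply]
    grind [List.reverse_reverse]
  · have l1 : (nb (a + b)).length ≤ N + 1 := length_nb_le (by lia)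
    have l2 := length_nb_le hb
    simp [update_apply, h2, h3, hx2.symm, hx3.symm, hy2.symm, hy3.symm]
    lia

/-- Double the number on `x`. -/
def double (x : Stack) : Prog :=
  pop x fun
    | none => skip
    | some b => seq (push x b) (push x (.bit false))

theorem within_double {x : Stack} {a : ℕ} {s : Store} (hsa : s x = nb a) :
    Within (double x) s (update s x (nb (2 * a))) 3 := by
  by_cases ha : a = 0
  · subst ha
    refine (Within.pop_nil hsa (.skip _)).congr ?_ (by lia)
    simp [← hsa]
  · have h2 := nb_bit false (.inr ha)
    have h1 := nb_of_ne_zero ha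
    rw [h1] at hsa
    refine (Within.pop_cons hsa (.seq (.push _ _ _) (.push _ _ _))).congr ?_ le_rfl
    simp only [Bool.toNat_false, add_zero] at h2
    simp [h2, h1]

/-- The multiplication loop: Horner's scheme for the bits on `tmp₃`, the highest bit on top. -/
def mulLoop (x y : Stack) : Prog :=
  loop tmp₃ fun
    | .bit true => seq (double x) (add x y)
    | _ => double x

/-- The intermediate results of Horner's scheme increase, so a bound on the last one suffices. -/
theorem le_foldl_horner (b : ℕ) (l : List Bool) (z : ℕ) :
    z ≤ l.foldl (fun z c => 2 * z + c.toNat * b) z := by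
  induction l generalizing z with
  | nil => exact le_rfl
  | cons c l ih => exact le_trans (by lia) (ih _)

/-- Horner's scheme for the binary digits of `a`, the highest first, computes `a * b`. -/
theorem foldl_horner (a b : ℕ) :
    (Computability.encodeNat a).reverse.foldl (fun z c => 2 * z + c.toNat * b) 0 = a * b := by
  rw [encodeNat_eq_bits]
  induction a using Nat.binaryRec' with
  | zero => simp
  | bit c n h ih =>
    rw [Nat.bits_append_bit _ _ h, List.reverse_cons, List.foldl_append, ih]
    cases c <;> simp [Nat.bit] <;> ring

theorem within_mulLoop {x y : Stack} (hxy : x ≠ y) (hx : IsReg x) (hy : IsReg y) {b N : ℕ}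
    (hb : b < 2 ^ N) (l : List Bool) :
    ∀ (z : ℕ) (s : Store), Clean s → l.foldl (fun z c => 2 * z + c.toNat * b) z < 2 ^ N →
      s x = nb z → s y = nb b → s tmp₃ = l.map .bit →
      Within (mulLoop x y) s
        (update (update s x (nb (l.foldl (fun z c => 2 * z + c.toNat * b) z))) tmp₃ [])
        (l.length * (10 * N + 20) + 1) := by
  have hx' := hx
  have hy' := hy
  obtain ⟨hx1, hx2, hx3, hx4⟩ := hx'
  obtain ⟨hy1, hy2, hy3, hy4⟩ := hy'
  induction l with
  | nil =>
    intro z s hs hz hsx hsy hst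
    refine (Within.loop_nil hst).congr ?_ (by simp)
    funext j
    simp only [update_apply, List.foldl_nil]
    grind
  | cons c l ih =>
    intro z s hs hz hsx hsy hst
    have hs' : Clean (update s tmp₃ (l.map .bit)) := by simpa [Clean] using hs
    have hz' := (le_foldl_horner b l _).trans_lt hz
    rw [List.foldl_cons] at hz ⊢
    cases c
    · simp only [Bool.toNat_false, zero_mul, add_zero] at hz ⊢
      refine (Within.loop_cons hst (within_double (a := z) (by simp [hx4, hsx]))
        (ih (2 * z) _ (hs'.update hx _) hz (by simp) (by simp [hxy.symm, hy4, hsy])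
        (by simp [hx4.symm]))).congr ?_ ?_
      · funext j
        simp only [update_apply]
        grind
      · simp [add_mul]
        lia
    · simp only [Bool.toNat_true, one_mul] at hz hz' ⊢
      refine (Within.loop_cons hst (.seq (within_double (a := z) (by simp [hx4, hsx]))
        (within_add hxy hx hy (a := 2 * z) (b := b) (N := N) (hs'.update hx _) (by lia) hb (by simp)
        (by simp [hxy.symm, hy4, hsy])))
        (ih (2 * z + b) _ ((hs'.update hx _).update hx _) hz (by simp) (by simp [hxy.symm, hy4, hsy])
        (by simp [hx4.symm]))).congr ?_ ?_
      · funext j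
        simp only [update_apply]
        grind
      · simp [add_mul]
        lia

/-- Multiply the number on `x` by the number on `y`. -/
def mul (x y : Stack) : Prog := seq (move x tmp₃) (mulLoop x y)

theorem within_mul {x y : Stack} (hxy : x ≠ y) (hx : IsReg x) (hy : IsReg y) {a b N : ℕ}
    {s : Store} (hs : Clean s) (hs' : s tmp₃ = []) (ha : a < 2 ^ N) (hb : b < 2 ^ N)
    (hab : a * b < 2 ^ N) (hsa : s x = nb a) (hsb : s y = nb b) :
    Within (mul x y) s (update s x (nb (a * b))) (22 * (N + 1) ^ 2) := by
  have hx' := hx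
  have hy' := hy
  obtain ⟨hx1, hx2, hx3, hx4⟩ := hx'
  obtain ⟨hy1, hy2, hy3, hy4⟩ := hy'
  rw [← foldl_horner a b] at hab
  refine (Within.seq (within_move hx4 _) (within_mulLoop hxy hx hy hb
    (Computability.encodeNat a).reverse 0 _ ?_ hab ?_ ?_ ?_)).congr ?_ ?_
  · simpa [Clean, update_apply, hx1.symm, hx2.symm, hx3.symm] using hs
  · simp
  · simp [hxy.symm, hy4, hsb]
  · simp [hx4.symm, hs', hsa, nb]
  · rw [foldl_horner]
    funext j
    simp only [update_apply]
    grind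
  · have l1 := length_nb_le ha
    have l2 : (Computability.encodeNat a).length ≤ N := by simpa [nb] using l1
    rw [List.length_reverse, hsa]
    calc 2 * (nb a).length + 1 + ((Computability.encodeNat a).length * (10 * N + 20) + 1)
        ≤ 2 * N + 1 + (N * (10 * N + 20) + 1) := by gcongr
      _ ≤ 22 * (N + 1) ^ 2 := by nlinarith

/-! ### Subtraction -/

/-- One digit of a subtraction with borrow `c`: the digit of the difference goes onto `tmp₁`, the
digits of both numbers are kept on `tmp₂` and `tmp₃`. A borrow that is left at the end is put onto
`con`. -/
def subDigit (c : Γ') (a b : Option Γ') : Prog :=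
  match a, b, c with
  | none, none, .bit false => skip
  | none, none, _ => push con (.bit true)
  | a, b, c =>
    seq (push tmp₁ (.bit ((digit a ^^ digit b) ^^ digit (some c))))
      (seq (keep tmp₂ a) (seq (keep tmp₃ b)
        (push ctl (.bit (!digit a && digit b || !digit a && digit (some c) ||
          digit b && digit (some c))))))

/-- The subtraction loop; the stack `ctl` holds the borrow. -/
def subLoop (x y : Stack) : Prog := loop ctl fun c => pop x fun a => pop y fun b => subDigit c a b

theorem subDigit_of_ne {c : Bool} {x y : ℕ} (h : x ≠ 0 ∨ y ≠ 0) :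
    subDigit (.bit c) (nb x).head? (nb y).head? =
      seq (push tmp₁ (.bit ((x + y + c.toNat) % 2 == 1)))
        (seq (keep tmp₂ (nb x).head?) (seq (keep tmp₃ (nb y).head?)
          (push ctl (.bit (decide (x % 2 < y % 2 + c.toNat)))))) := by
  have e1 : ((digit (nb x).head? ^^ digit (nb y).head?) ^^ digit (some (.bit c))) =
      ((x + y + c.toNat) % 2 == 1) := by
    rw [digit_head?_nb, digit_head?_nb]
    rcases Nat.mod_two_eq_zero_or_one x with hx | hx <;>
      rcases Nat.mod_two_eq_zero_or_one y with hy | hy <;> cases c <;>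
        simp [Nat.add_mod, hx, hy, digit]
  have e2 : (!digit (nb x).head? && digit (nb y).head? ||
      !digit (nb x).head? && digit (some (.bit c)) ||
      digit (nb y).head? && digit (some (.bit c))) =
      decide (x % 2 < y % 2 + c.toNat) := by
    rw [digit_head?_nb, digit_head?_nb]
    rcases Nat.mod_two_eq_zero_or_one x with hx | hx <;>
      rcases Nat.mod_two_eq_zero_or_one y with hy | hy <;> cases c <;>
        simp [hx, hy, digit]
  rw [← e1, ← e2]
  have hx := head?_nb_eq_none (n := x)
  have hy := head?_nb_eq_none (n := y)
  unfold subDigit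
  split <;> simp_all

/-- The digits of `a - b - c`, followed by zeros, and whether a borrow is left over. -/
def IsDiff (a b c : ℕ) (ds : List Γ') (borrow : List Γ') : Prop :=
  (b + c ≤ a → borrow = [] ∧ ∃ m, ds = nb (a - b - c) ++ List.replicate m (.bit false)) ∧
    (a < b + c → borrow = [.bit true])

theorem within_subLoop {x y : Stack} (hxy : x ≠ y) (hx : IsReg x) (hy : IsReg y)
    (hxc : x ≠ con) (hyc : y ≠ con) (N : ℕ) :
    ∀ (a b : ℕ) (c : Bool) (s : Store), a < 2 ^ N → b < 2 ^ N → s x = nb a → s y = nb b →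
      s ctl = [.bit c] → s con = [] →
      ∃ ds borrow, IsDiff a b c.toNat ds borrow ∧ ds.length ≤ N ∧ Within (subLoop x y) s
        (update (update (update (update (update (update (update s tmp₁ (ds.reverse ++ s tmp₁))
          tmp₂ ((nb a).reverse ++ s tmp₂)) tmp₃ ((nb b).reverse ++ s tmp₃)) x []) y []) ctl [])
          con borrow) (7 * N + 7) := by
  obtain ⟨hx1, hx2, hx3, hx4⟩ := hx
  obtain ⟨hy1, hy2, hy3, hy4⟩ := hy
  have base : ∀ (N : ℕ) (c : Bool) (s : Store), s x = nb 0 → s y = nb 0 → s ctl = [.bit c] →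
      s con = [] → ∃ ds borrow, IsDiff 0 0 c.toNat ds borrow ∧ ds.length ≤ N ∧
        Within (subLoop x y) s
        (update (update (update (update (update (update (update s tmp₁ (ds.reverse ++ s tmp₁))
          tmp₂ ((nb 0).reverse ++ s tmp₂)) tmp₃ ((nb 0).reverse ++ s tmp₃)) x []) y []) ctl [])
          con borrow) (7 * N + 7) := by
    intro N c s hsa hsb hc hcon
    cases c
    · refine ⟨[], [], ⟨fun _ => ⟨rfl, 0, rfl⟩, by simp⟩, by simp, ?_⟩
      refine (Within.loop_cons hc (.pop_nil (by simp [hx1, hsa]) (.pop_nil (by simp [hy1, hsb])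
        (.skip _))) (.loop_nil (by simp))).congr ?_ (by lia)
      funext j
      simp [update_apply]
      grind [nb_zero]
    · refine ⟨[], [.bit true], ⟨by simp, by simp⟩, by simp, ?_⟩
      refine (Within.loop_cons hc (.pop_nil (by simp [hx1, hsa]) (.pop_nil (by simp [hy1, hsb])
        (.push _ _ _))) (.loop_nil (by simp))).congr ?_ (by lia)
      funext j
      simp [update_apply]
      grind [nb_zero]
  induction N with
  | zero =>
    intro a b c s ha hb hsa hsb hc hcon
    obtain rfl : a = 0 := by simpa using ha
    obtain rfl : b = 0 := by simpa using hb
    exact base 0 c s hsa hsb hc hcon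
  | succ N ih =>
    intro a b c s ha hb hsa hsb hc hcon
    by_cases h0 : a = 0 ∧ b = 0
    · obtain ⟨rfl, rfl⟩ := h0
      exact base _ c s hsa hsb hc hcon
    obtain ⟨ds, borrow, hd, hl, hw⟩ := ih (a / 2) (b / 2) (decide (a % 2 < b % 2 + c.toNat))
      (update (update (update (update (update (update s x (nb (a / 2))) y (nb (b / 2)))
        tmp₁ (.bit ((a + b + c.toNat) % 2 == 1) :: s tmp₁))
        tmp₂ ((nb a).head?.toList ++ s tmp₂)) tmp₃ ((nb b).head?.toList ++ s tmp₃))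
        ctl [.bit (decide (a % 2 < b % 2 + c.toNat))]) (by lia) (by lia)
      (by simp only [update_apply]; grind) (by simp only [update_apply]; grind) (by simp)
      (by simp only [update_apply]; grind)
    refine ⟨.bit ((a + b + c.toNat) % 2 == 1) :: ds, borrow, ?_, by simpa using hl, ?_⟩
    · have hc1 := Bool.toNat_le c
      set c' := decide (a % 2 < b % 2 + c.toNat) with hc'
      have hc2 : c'.toNat = if a % 2 < b % 2 + c.toNat then 1 else 0 := by
        by_cases h : a % 2 < b % 2 + c.toNat <;> simp [hc', h]
      constructor
      · intro hle
        obtain ⟨h1, m, h2⟩ := hd.1 (by split_ifs at hc2 <;> lia)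
        refine ⟨h1, ?_⟩
        have e1 : a / 2 - b / 2 - c'.toNat = (a - b - c.toNat) / 2 := by
          split_ifs at hc2 <;> lia
        have e2 : (a + b + c.toNat) % 2 = (a - b - c.toNat) % 2 := by lia
        rw [h2, e1, e2]
        by_cases hz : a - b - c.toNat = 0
        · exact ⟨m + 1, by simp [hz, List.replicate_succ]⟩
        · exact ⟨m, by rw [nb_of_ne_zero hz, List.cons_append]⟩
      · intro hlt
        exact hd.2 (by split_ifs at hc2 <;> lia)
    · refine (Within.loop_cons hc (within_pop_nb (n := a) (by simp [hx1, hsa])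
        (within_pop_nb (n := b) (T := 4) (by simp [hy1, hsb, hxy.symm]) ?_)) hw).congr ?_ (by lia)
      · rw [subDigit_of_ne (by lia)]
        refine (Within.seq (.push _ _ _) (.seq (within_keep _ _ _) (.seq (within_keep _ _ _)
          (.push _ _ _)))).congr ?_ le_rfl
        funext j
        simp only [update_apply]
        grind
      · have e2 := reverse_nb_half_append a (s tmp₂)
        have e3 := reverse_nb_half_append b (s tmp₃)
        rw [List.reverse_cons, ← e2, ← e3]
        funext j
        simp only [update_apply]
        grind

/-! ### Absolute differences -/

/-- Remove leading zeros from a number whose highest bit is on top of `tmp₁`. -/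
def strip : Prog :=
  seq (push ctl .blank) (loop ctl fun _ => pop tmp₁ fun
    | some (.bit false) => push ctl .blank
    | some a => push tmp₁ a
    | none => skip)

theorem within_strip (n m : ℕ) {s : Store} (hc : s ctl = [])
    (ht : s tmp₁ = List.replicate m (.bit false) ++ (nb n).reverse) :
    Within strip s (update s tmp₁ (nb n).reverse) (3 * m + 5) := by
  unfold strip
  suffices H : ∀ s : Store, s ctl = [.blank] →
      s tmp₁ = List.replicate m (.bit false) ++ (nb n).reverse →
      Within (loop ctl fun _ => pop tmp₁ fun
        | some (.bit false) => push ctl .blank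
        | some a => push tmp₁ a
        | none => skip) s (update (update s tmp₁ (nb n).reverse) ctl []) (3 * m + 4) by
    refine (Within.seq (.push _ _ _) (H _ (by simp [hc]) (by simpa using ht))).congr ?_ (by lia)
    funext j
    simp only [update_apply]
    grind
  clear hc ht s
  induction m with
  | zero =>
    intro s hc ht
    rw [List.replicate_zero, List.nil_append] at ht
    by_cases hn : n = 0
    · subst hn
      refine (Within.loop_cons hc (.pop_nil (by simpa using ht) (.skip _))
        (.loop_nil (by simp))).congr ?_ (by lia)
      funext j
      simp only [update_apply]
      grind
    · obtain ⟨l, hl⟩ := exists_nb_eq_append n hn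
      rw [hl, List.reverse_append, List.reverse_singleton, List.singleton_append] at ht ⊢
      refine (Within.loop_cons hc (.pop_cons (by simpa using ht) (.push _ _ _))
        (.loop_nil (by simp))).congr ?_ (by lia)
      funext j
      simp only [update_apply]
      grind
  | succ m ih =>
    intro s hc ht
    rw [List.replicate_succ, List.cons_append] at ht
    refine (Within.loop_cons hc (.pop_cons (by simpa using ht) (.push _ _ _))
        (ih _ (by simp) (by simp))).congr ?_ (by lia)
    funext j
    simp only [update_apply]
    grind

/-- Finish a subtraction: drop the copies of the two numbers and store the difference. -/
def finishDiff : Prog := seq (clear tmp₂) (seq (clear tmp₃) (seq strip (move tmp₁ pos)))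

theorem within_finishDiff (n m : ℕ) {s : Store} (hc : s ctl = []) (hp : s pos = [])
    (ht : s tmp₁ = List.replicate m (.bit false) ++ (nb n).reverse) :
    Within finishDiff s (update (update (update (update s pos (nb n)) tmp₁ []) tmp₂ []) tmp₃ [])
      (2 * (s tmp₂).length + 2 * (s tmp₃).length + 3 * m + 2 * (nb n).length + 8) := by
  refine (Within.seq (within_clear _ _) (.seq (within_clear _ _)
    (.seq (within_strip n m ?_ ?_) (within_move (by decide) _)))).congr ?_ ?_
  · simpa using hc
  · simpa using ht
  · funext j
    simp [update_apply]
    grind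
  · simp
    lia

/-- Redo a subtraction the other way round, from the copies of the two numbers. -/
def swapDiff : Prog :=
  seq (clear tmp₁) (seq (move tmp₂ pos) (seq (move tmp₃ neg)
    (seq (push ctl (.bit false)) (seq (subLoop neg pos) finishDiff))))

theorem within_swapDiff {a b N : ℕ} {s : Store} (hc : s ctl = []) (hcon : s con = [])
    (hp : s pos = []) (hn : s neg = []) (h1 : (s tmp₁).length ≤ N) (h2 : s tmp₂ = (nb a).reverse)
    (h3 : s tmp₃ = (nb b).reverse) (ha : a < 2 ^ N) (hb : b < 2 ^ N) (hab : a ≤ b) :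
    Within swapDiff s
      (update (update (update (update s pos (nb (b - a))) tmp₁ []) tmp₂ []) tmp₃ [])
      (24 * N + 24) := by
  have la := length_nb_le ha
  have lb := length_nb_le hb
  have lc := length_nb_le (show b - a < 2 ^ N by lia)
  obtain ⟨ds, borrow, hd, hl, hw2⟩ := within_subLoop (x := neg) (y := pos) (by decide)
      (by decide) (by decide) (by decide) (by decide) N b a false
      (update (update (update (update (update (update s tmp₁ []) tmp₂ []) tmp₃ [])
        pos (nb a)) neg (nb b)) ctl [.bit false]) hb ha
      (by simp) (by simp) (by simp) (by simp [hcon])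
  obtain ⟨rfl, m, rfl⟩ := hd.1 (by simpa using hab)
  simp only [Bool.toNat_false, Nat.sub_zero] at hw2 hl
  have hm : m ≤ N := by simp at hl; lia
  have hw3 := hw2.seq (within_finishDiff (b - a) m (by simp) (by simp) (by simp))
  refine ((within_clear tmp₁ s).seq ((within_move (k := tmp₂) (l := pos) (by decide) _).seq
    ((within_move (k := tmp₃) (l := neg) (by decide) _).seq
    ((Within.push ctl (.bit false) _).seq (hw3.of_eq ?_))))).congr ?_ ?_
  · funext j
    simp [update_apply]
    grind [List.reverse_reverse]
  · funext j
    simp [update_apply]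
    grind
  · simp [h2, h3]
    lia

/-- Replace `pos` by the absolute value of the difference of `pos` and `neg`, empty `neg`, and put
the sign of the difference onto `out`. -/
def absDiff : Prog :=
  seq (push ctl (.bit false)) (seq (subLoop pos neg) (pop con fun
    | none => seq (push out (.bit false)) finishDiff
    | some _ => seq (push out (.bit true)) swapDiff))

theorem within_absDiff {a b N : ℕ} {s : Store} (hs : Clean s) (hs' : s tmp₃ = [])
    (hcon : s con = []) (ha : a < 2 ^ N) (hb : b < 2 ^ N) (hsa : s pos = nb a)
    (hsb : s neg = nb b) :
    Within absDiff s (update (update (update s out (.bit (decide (a < b)) :: s out))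
      pos (nb ((a : ℤ) - b).natAbs)) neg []) (32 * N + 40) := by
  obtain ⟨h1, h2, h3⟩ := hs
  have la := length_nb_le ha
  have lb := length_nb_le hb
  obtain ⟨ds, borrow, hd, hl, hw⟩ := within_subLoop (x := pos) (y := neg) (by decide) (by decide)
    (by decide) (by decide) (by decide) N a b false (update s ctl (.bit false :: s ctl)) ha hb
    (by simpa) (by simpa) (by simp [h1]) (by simpa)
  simp only [Bool.toNat_false] at hd
  by_cases hab : a < b
  · obtain rfl := hd.2 (by lia)
    have hn : ((a : ℤ) - b).natAbs = b - a := by lia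
    refine ((Within.push ctl (.bit false) s).seq (hw.seq (.pop_cons (update_self _ _ _)
      (.seq (.push _ _ _) (within_swapDiff (a := a) (b := b) (N := N) ?_ ?_ ?_ ?_ ?_ ?_ ?_
        ha hb hab.le))))).congr ?_ ?_
    all_goals try simp [h1, h2, h3, hs', hl]
    · funext j
      simp only [update_apply, hab, hn]
      grind
    · lia
  · obtain ⟨rfl, m, rfl⟩ := hd.1 (by lia)
    have hn : ((a : ℤ) - b).natAbs = a - b := by lia
    have lc := length_nb_le (show a - b < 2 ^ N by lia)
    have hm : m ≤ N := by simp at hl; lia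
    refine ((Within.push ctl (.bit false) s).seq (hw.seq (.pop_nil (update_self _ _ _)
      (.seq (.push _ _ _) (within_finishDiff (a - b) m ?_ ?_ ?_))))).congr ?_ ?_
    all_goals try simp [h1, h2, h3, hs']
    · funext j
      simp only [update_apply, hab, hn]
      grind
    · lia

/-! ### Sums of fractions -/

theorem enc_nat_eq (n : ℕ) : Enc.nat n = nb n ++ [.comma] := rfl

/-- Read a number from the text on `tab'` and put it onto `k`. -/
def readNat (k : Stack) : Prog :=
  seq (push ctl .blank) (seq (loop ctl fun _ => pop tab' fun
    | some (.bit b) => seq (push tmp₁ (.bit b)) (push ctl .blank)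
    | _ => skip) (move tmp₁ k))

theorem within_readNat {k : Stack} (hk : IsReg k) (hk' : k ≠ tab') {n : ℕ} {r : List Γ'}
    {s : Store} (hs : Clean s) (hsk : s k = []) (ht : s tab' = Enc.nat n ++ r) :
    Within (readNat k) s (update (update s k (nb n)) tab' r) (6 * (nb n).length + 6) := by
  obtain ⟨h1, h2, h3, h4⟩ := hk
  obtain ⟨c1, c2, c3⟩ := hs
  have H : ∀ (l : List Bool) (s : Store), s ctl = [.blank] →
      s tab' = l.map .bit ++ .comma :: r →
      Within (loop ctl fun _ => pop tab' fun
        | some (.bit b) => seq (push tmp₁ (.bit b)) (push ctl .blank)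
        | _ => skip) s
        (update (update (update s ctl []) tab' r) tmp₁ ((l.map .bit).reverse ++ s tmp₁))
        (4 * l.length + 4) := by
    intro l
    induction l with
    | nil =>
      intro s hc ht
      refine (Within.loop_cons hc (.pop_cons (by simpa using ht) (.skip _))
        (.loop_nil (by simp))).congr ?_ (by simp)
      funext j
      simp [update_apply]
      grind
    | cons b l ih =>
      intro s hc ht
      refine (Within.loop_cons hc (.pop_cons (a := .bit b) (l := l.map .bit ++ .comma :: r)
        (by simpa using ht) (.seq (.push _ _ _) (.push _ _ _)))
        (ih _ (by simp) (by simp))).congr ?_ ?_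
      · funext j
        simp [update_apply]
        grind
      · simp
        lia
  refine (Within.seq (.push _ _ _) (.seq (H (Computability.encodeNat n) _ (by simp [c1]) ?_)
    (within_move h2.symm _))).congr ?_ ?_
  · simpa [enc_nat_eq, nb] using ht
  · funext j
    simp [update_apply]
    grind [nb]
  · simp [c2, nb]
    lia

/-- Multiply the number on `k` by the constant `c`. -/
def mulConst (k : Stack) (c : ℕ) : Prog := seq (load con (nb c)) (seq (mul k con) (clear con))

theorem within_mulConst {k : Stack} (hk : IsReg k) (hk' : k ≠ con) {a c N : ℕ} {s : Store}
    (hs : Clean s) (hs' : s tmp₃ = []) (hcon : s con = []) (ha : a < 2 ^ N) (hc : c < 2 ^ N)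
    (hac : a * c < 2 ^ N) (hsa : s k = nb a) :
    Within (mulConst k c) s (update s k (nb (a * c))) (25 * (N + 1) ^ 2) := by
  refine (Within.seq (within_load _ _ _) (.seq (within_mul hk' hk (by decide) (N := N)
    (hs.update (by decide) _) (by simpa) ha hc hac (by simpa [hk'])
    (by simp [hcon])) (within_clear _ _))).congr ?_ ?_
  · funext j
    simp only [update_apply]
    grind
  · have := length_nb_le hc
    simp [hcon, hk'.symm]
    nlinarith

/-- The numbers on the stacks `pos`, `neg` and `den` while a sum of fractions is computed; they
stand for the fraction `(pos - neg) / den`. -/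
@[ext] structure Acc where
  pos : ℕ
  neg : ℕ
  den : ℕ

/-- Add `p / d` times the fraction `q`. -/
def Acc.step (A : Acc) (p d : ℕ) (q : Frac) : Acc where
  pos := A.pos * (q.den * d) + if q.num < 0 then 0 else q.num.natAbs * p * A.den
  neg := A.neg * (q.den * d) + if q.num < 0 then q.num.natAbs * p * A.den else 0
  den := A.den * (q.den * d)

/-- Add `p / d` times the fraction with the absolute values of numerator and denominator on `numr`
and `denr`, and with the sign shown by `o`. -/
def combine (p d : ℕ) (o : Option Γ') : Prog :=
  seq (mulConst denr d) (seq (mulConst numr p) (seq (mul numr den) (seq (mul pos denr)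
    (seq (mul neg denr) (seq (mul den denr)
    (seq (if o = some (.bit true) then add neg numr else add pos numr)
      (seq (clear numr) (clear denr))))))))

/-- Read a fraction from the text on `tab'` and add `p / d` times this fraction to the sum. -/
def accumulate (p d : ℕ) : Prog :=
  pop tab' fun o => seq (readNat numr) (seq (readNat denr) (combine p d o))

/-- The stacks that hold intermediate results of a sum of fractions are empty. -/
structure Ready (s : Store) : Prop where
  clean : Clean s
  tmp₃ : s tmp₃ = []
  con : s con = []
  numr : s numr = []
  denr : s denr = []

theorem mul_lt_two_pow {x y i j k : ℕ} (hx : x < 2 ^ i) (hy : y < 2 ^ j) (h : i + j ≤ k) :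
    x * y < 2 ^ k :=
  calc x * y < 2 ^ i * 2 ^ j := Nat.mul_lt_mul'' hx hy
    _ = 2 ^ (i + j) := (pow_add 2 i j).symm
    _ ≤ 2 ^ k := Nat.pow_le_pow_right (by lia) h

theorem lt_two_pow_mono {x i k : ℕ} (hx : x < 2 ^ i) (h : i ≤ k) : x < 2 ^ k :=
  hx.trans_le (Nat.pow_le_pow_right (by lia) h)

/-- All the numbers are less than `2 ^ S`. -/
structure Acc.Below (A : Acc) (S : ℕ) : Prop where
  pos : A.pos < 2 ^ S
  neg : A.neg < 2 ^ S
  den : A.den < 2 ^ S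

theorem Acc.Below.step {A : Acc} {S c L p d : ℕ} {q : Frac} (hA : A.Below S) (hp : p < 2 ^ c)
    (hd : d < 2 ^ c) (hqn : q.num.natAbs < 2 ^ L) (hqd : q.den < 2 ^ L) :
    (A.step p d q).Below (S + L + c + 1) := by
  have hD := mul_lt_two_pow hqd hd le_rfl
  have hn := mul_lt_two_pow (mul_lt_two_pow hqn hp le_rfl) hA.den
    (show _ ≤ S + L + c by lia)
  have h1 := mul_lt_two_pow hA.pos hD (show _ ≤ S + L + c by lia)
  have h2 := mul_lt_two_pow hA.neg hD (show _ ≤ S + L + c by lia)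
  have h3 := mul_lt_two_pow hA.den hD (show _ ≤ S + L + c + 1 by lia)
  have h4 := pow_succ 2 (S + L + c)
  refine ⟨?_, ?_, h3⟩ <;> simp only [Acc.step] <;> split_ifs <;> lia

theorem enc_frac_append (q : Frac) (r : List Γ') : Enc.frac q ++ r =
    .bit (decide (q.num < 0)) :: (Enc.nat q.num.natAbs ++ (Enc.nat q.den ++ r)) := by
  simp [Enc.frac]

/-- All the numbers involved stay below `2 ^ (S + L + c + 1)`, so that a bounded number of
multiplications takes time quadratic in this exponent. -/
theorem within_combine {p d S c L : ℕ} {q : Frac} {A : Acc} {s : Store}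
    (hcl : Clean s) (ht : s tmp₃ = []) (hco : s con = []) (hA : A.Below S) (hp : p < 2 ^ c)
    (hd : d < 2 ^ c) (hqn : q.num.natAbs < 2 ^ L) (hqd : q.den < 2 ^ L)
    (h1 : s pos = nb A.pos) (h2 : s neg = nb A.neg) (h3 : s den = nb A.den)
    (h4 : s numr = nb q.num.natAbs) (h5 : s denr = nb q.den) :
    Within (combine p d (some (.bit (decide (q.num < 0))))) s
      (update (update (update (update (update s pos (nb (A.step p d q).pos))
        neg (nb (A.step p d q).neg)) den (nb (A.step p d q).den)) numr []) denr [])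
      (170 * (S + L + c + 2) ^ 2) := by
  have hstep := hA.step hp hd hqn hqd
  have bD : q.den * d < 2 ^ (S + L + c + 1) := mul_lt_two_pow hqd hd (by lia)
  have bn : q.num.natAbs * p < 2 ^ (S + L + c + 1) := mul_lt_two_pow hqn hp (by lia)
  have bn' : q.num.natAbs * p * A.den < 2 ^ (S + L + c + 1) :=
    mul_lt_two_pow (mul_lt_two_pow hqn hp le_rfl) hA.den (by lia)
  have bP : A.pos * (q.den * d) < 2 ^ (S + L + c + 1) :=
    mul_lt_two_pow hA.pos (mul_lt_two_pow hqd hd le_rfl) (by lia)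
  have bN : A.neg * (q.den * d) < 2 ^ (S + L + c + 1) :=
    mul_lt_two_pow hA.neg (mul_lt_two_pow hqd hd le_rfl) (by lia)
  have w1 := within_mulConst (k := denr) (by decide) (by decide) hcl ht hco
    (lt_two_pow_mono hqd (by lia)) (lt_two_pow_mono hd (by lia)) bD h5
  have w2 := within_mulConst (k := numr) (s := update s denr (nb (q.den * d)))
    (by decide) (by decide) (by simpa [Clean] using hcl) (by simpa) (by simpa)
    (lt_two_pow_mono hqn (by lia)) (lt_two_pow_mono hp (by lia)) bn (by simpa)
  have w3 := within_mul (x := numr) (y := den) (by decide) (by decide) (by decide)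
    (s := update (update s denr (nb (q.den * d))) numr (nb (q.num.natAbs * p)))
    (by simpa [Clean] using hcl) (by simpa) bn (lt_two_pow_mono hA.den (by lia)) bn'
    (by simp) (by simpa)
  have w4 := within_mul (x := pos) (y := denr) (by decide) (by decide) (by decide)
    (s := update (update (update s denr (nb (q.den * d))) numr (nb (q.num.natAbs * p)))
      numr (nb (q.num.natAbs * p * A.den)))
    (by simpa [Clean] using hcl) (by simpa) (lt_two_pow_mono hA.pos (by lia)) bD bP
    (by simpa) (by simp)
  have w5 := within_mul (x := neg) (y := denr) (by decide) (by decide) (by decide)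
    (s := update (update (update (update s denr (nb (q.den * d))) numr (nb (q.num.natAbs * p)))
      numr (nb (q.num.natAbs * p * A.den))) pos (nb (A.pos * (q.den * d))))
    (by simpa [Clean] using hcl) (by simpa) (lt_two_pow_mono hA.neg (by lia)) bD bN
    (by simpa) (by simp)
  have w6 := within_mul (x := den) (y := denr) (by decide) (by decide) (by decide)
    (s := update (update (update (update (update s denr (nb (q.den * d)))
      numr (nb (q.num.natAbs * p)))
      numr (nb (q.num.natAbs * p * A.den))) pos (nb (A.pos * (q.den * d))))
      neg (nb (A.neg * (q.den * d))))
    (by simpa [Clean] using hcl) (by simpa) (lt_two_pow_mono hA.den (by lia)) bD hstep.den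
    (by simpa) (by simp)
  generalize hs6 : @update Stack (fun _ => List Γ') _ _ den (nb (A.den * (q.den * d))) = s6 at w6
  have hcl6 : Clean s6 := by subst hs6; simpa [Clean] using hcl
  have w7 : Within (if some (Γ'.bit (decide (q.num < 0))) = some (.bit true) then add neg numr
      else add pos numr) s6 (update (update s6 pos (nb (A.step p d q).pos))
        neg (nb (A.step p d q).neg)) (10 * (S + L + c + 1) + 16) := by
    by_cases hq : q.num < 0
    · have e1 : (A.step p d q).pos = A.pos * (q.den * d) := by simp [Acc.step, hq]
      have e2 : (A.step p d q).neg = A.neg * (q.den * d) + q.num.natAbs * p * A.den := by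
        simp [Acc.step, hq]
      rw [if_pos (by simp [hq]), e1, e2]
      refine (within_add (x := neg) (y := numr) (by decide) (by decide) (by decide) hcl6 bN bn'
        (by subst hs6; simp) (by subst hs6; simp)).congr ?_ le_rfl
      subst hs6
      funext j
      simp only [update_apply]
      grind
    · have e1 : (A.step p d q).pos = A.pos * (q.den * d) + q.num.natAbs * p * A.den := by
        simp [Acc.step, hq]
      have e2 : (A.step p d q).neg = A.neg * (q.den * d) := by simp [Acc.step, hq]
      rw [if_neg (by simp [hq]), e1, e2]
      refine (within_add (x := pos) (y := numr) (by decide) (by decide) (by decide) hcl6 bP bn'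
        (by subst hs6; simp) (by subst hs6; simp)).congr ?_ le_rfl
      subst hs6
      funext j
      simp only [update_apply]
      grind
  refine (w1.seq (w2.seq (w3.seq (w4.seq (w5.seq (w6.seq (w7.seq
    ((within_clear _ _).seq (within_clear _ _))))))))).congr ?_ ?_
  · subst hs6
    funext j
    simp only [update_apply]
    grind [Acc.step]
  · subst hs6
    have l1 := length_nb_le bD
    have l2 := length_nb_le bn'
    simp
    nlinarith

theorem within_accumulate {p d S c L : ℕ} {q : Frac} {A : Acc} {r : List Γ'} {s : Store}
    (hs : Ready s) (hA : A.Below S) (hp : p < 2 ^ c)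
    (hd : d < 2 ^ c) (hqn : q.num.natAbs < 2 ^ L) (hqd : q.den < 2 ^ L)
    (ht : s tab' = Enc.frac q ++ r) (h1 : s pos = nb A.pos) (h2 : s neg = nb A.neg)
    (h3 : s den = nb A.den) :
    Within (accumulate p d) s
      (update (update (update (update s tab' r) pos (nb (A.step p d q).pos))
        neg (nb (A.step p d q).neg)) den (nb (A.step p d q).den))
      (200 * (S + L + c + 2) ^ 2) := by
  obtain ⟨hcl, ht3, hco, hnu, hde⟩ := hs
  rw [enc_frac_append] at ht
  have w1 := within_readNat (k := numr) (by decide) (by decide) (n := q.num.natAbs)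
    (r := Enc.nat q.den ++ r) (s := update s tab' (Enc.nat q.num.natAbs ++ (Enc.nat q.den ++ r)))
    (by simpa [Clean] using hcl) (by simpa) (by simp)
  have w2 := within_readNat (k := denr) (by decide) (by decide) (n := q.den) (r := r)
    (s := update (update s tab' (Enc.nat q.den ++ r)) numr (nb q.num.natAbs))
    (by simpa [Clean] using hcl) (by simpa) (by simp)
  have w3 := within_combine (p := p) (d := d) (S := S) (c := c) (L := L) (q := q) (A := A)
    (s := update (update (update s tab' r) numr (nb q.num.natAbs)) denr (nb q.den))
    (by simpa [Clean] using hcl) (by simpa) (by simpa) hA hp hd hqn hqd (by simpa) (by simpa)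
    (by simpa) (by simp) (by simp)
  refine (Within.pop_cons ht (w1.seq ((w2.of_eq ?_).seq (w3.of_eq ?_)))).congr ?_ ?_
  · funext j
    simp only [update_apply]
    grind
  · funext j
    simp only [update_apply]
    grind
  · funext j
    simp only [update_apply]
    grind
  · have l1 := length_nb_le hqn
    have l2 := length_nb_le hqd
    have l3 := Nat.le_self_pow two_ne_zero (S + L + c + 2)
    generalize (S + L + c + 2) ^ 2 = Z at l3 ⊢
    lia

/-- Add the first fractions of the text on `tab'`, with the given coefficients, to the sum on the
stacks `pos`, `neg` and `den`. -/
def accumulateList : List ℚ≥0 → Prog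
  | [] => skip
  | w :: ws => seq (accumulate w.num w.den) (accumulateList ws)

/-- Add the fractions `qs` with coefficients `ws` to a sum. -/
def Acc.sum (A : Acc) : List ℚ≥0 → List Frac → Acc
  | w :: ws, q :: qs => (A.step w.num w.den q).sum ws qs
  | _, _ => A

theorem length_enc_frac (q : Frac) :
    (Enc.frac q).length = (nb q.num.natAbs).length + (nb q.den).length + 3 := by
  simp [Enc.frac, enc_nat_eq]
  lia

theorem natAbs_num_lt {q : Frac} {L : ℕ} (h : (Enc.frac q).length ≤ L) :
    q.num.natAbs < 2 ^ L :=
  lt_two_pow_mono (lt_two_pow_length_nb _) (by rw [length_enc_frac] at h; lia)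

theorem den_lt {q : Frac} {L : ℕ} (h : (Enc.frac q).length ≤ L) : q.den < 2 ^ L :=
  lt_two_pow_mono (lt_two_pow_length_nb _) (by rw [length_enc_frac] at h; lia)

/-- A sum of fractions with fixed coefficients takes quadratic time: every step multiplies the
numbers by factors of at most linear length, and the number of steps is fixed. -/
theorem within_accumulateList (ws : List ℚ≥0) : ∃ C, ∀ (L S : ℕ) (qs : List Frac) (A : Acc)
    (r : List Γ') (s : Store), qs.length = ws.length → (qs.flatMap Enc.frac).length ≤ L →
    Ready s → A.Below S → s tab' = qs.flatMap Enc.frac ++ r →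
    s pos = nb A.pos → s neg = nb A.neg → s den = nb A.den →
    (A.sum ws qs).Below (S + C * (L + 1)) ∧
    Within (accumulateList ws) s
      (update (update (update (update s tab' r) pos (nb (A.sum ws qs).pos))
        neg (nb (A.sum ws qs).neg)) den (nb (A.sum ws qs).den)) (C * (S + L + 1) ^ 2) := by
  induction ws with
  | nil =>
    refine ⟨1, fun L S qs A r s hqs hL hs hA ht h1 h2 h3 => ?_⟩
    obtain rfl : qs = [] := by simpa using hqs
    refine ⟨⟨lt_two_pow_mono hA.1 (by lia), lt_two_pow_mono hA.2 (by lia),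
      lt_two_pow_mono hA.3 (by lia)⟩, (Within.skip s).congr ?_ ?_⟩
    · funext j
      simp only [update_apply, Acc.sum]
      grind
    · rw [one_mul]
      exact Nat.one_le_pow _ _ (by lia)
  | cons w ws ih =>
    obtain ⟨C, hC⟩ := ih
    obtain ⟨c, hc⟩ : ∃ c, w.num < 2 ^ c ∧ w.den < 2 ^ c :=
      ⟨w.num + w.den, lt_two_pow_mono Nat.lt_two_pow_self (by lia),
        lt_two_pow_mono Nat.lt_two_pow_self (by lia)⟩
    refine ⟨(200 + C) * (c + 2) ^ 2 + C + c + 1, fun L S qs A r s hqs hL hs hA ht h1 h2 h3 => ?_⟩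
    obtain _ | ⟨q, qs⟩ := qs
    · simp at hqs
    rw [List.flatMap_cons, List.append_assoc] at ht
    rw [List.flatMap_cons, List.length_append] at hL
    have hqn := natAbs_num_lt (q := q) (L := L) (by lia)
    have hqd := den_lt (q := q) (L := L) (by lia)
    have w1 := within_accumulate hs hA hc.1 hc.2 hqn hqd ht h1 h2 h3
    obtain ⟨hb, w2⟩ := hC L (S + L + c + 1) qs (A.step w.num w.den q) r
      (update (update (update (update s tab' (qs.flatMap Enc.frac ++ r))
        pos (nb (A.step w.num w.den q).pos)) neg (nb (A.step w.num w.den q).neg))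
        den (nb (A.step w.num w.den q).den)) (by simpa using hqs) (by lia)
      (by obtain ⟨h1, h2, h3, h4, h5⟩ := hs; constructor <;> simpa [Clean]) (hA.step hc.1 hc.2 hqn hqd)
      (by simp) (by simp) (by simp) (by simp)
    have hle : S + L + c + 1 + C * (L + 1) ≤
        S + ((200 + C) * (c + 2) ^ 2 + C + c + 1) * (L + 1) := by
      have : 0 ≤ (200 + C) * (c + 2) ^ 2 * (L + 1) := Nat.zero_le _
      nlinarith
    refine ⟨⟨lt_two_pow_mono hb.1 hle, lt_two_pow_mono hb.2 hle, lt_two_pow_mono hb.3 hle⟩,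
      (w1.seq w2).congr ?_ ?_⟩
    · funext j
      simp only [update_apply, Acc.sum]
      grind
    · have e1 : S + L + c + 2 ≤ (c + 2) * (S + L + 1) := by nlinarith
      have e2 : S + L + c + 1 + L + 1 ≤ (c + 2) * (S + L + 1) := by nlinarith
      calc 200 * (S + L + c + 2) ^ 2 + C * (S + L + c + 1 + L + 1) ^ 2
          ≤ 200 * ((c + 2) * (S + L + 1)) ^ 2 + C * ((c + 2) * (S + L + 1)) ^ 2 := by gcongr
        _ = (200 + C) * (c + 2) ^ 2 * (S + L + 1) ^ 2 := by ring
        _ ≤ _ := Nat.mul_le_mul_right _ (by lia)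

/-- The sum of the fractions `qs` with coefficients `ws`, as it is computed, not reduced to lowest
terms. -/
def sumFrac (ws : List ℚ≥0) (qs : List Frac) : Frac where
  num := ((Acc.mk 0 0 1).sum ws qs).pos - ((Acc.mk 0 0 1).sum ws qs).neg
  den := ((Acc.mk 0 0 1).sum ws qs).den
  den_pos := by
    suffices h : ∀ A : Acc, 0 < A.den → 0 < (A.sum ws qs).den from h _ one_pos
    induction ws generalizing qs with
    | nil => intro A hA; cases qs <;> exact hA
    | cons w ws ih =>
      intro A hA
      cases qs with
      | nil => exact hA
      | cons q qs => exact ih qs _ (Nat.mul_pos hA (Nat.mul_pos q.den_pos w.den_pos))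

/-! ### Emitting the output payoffs -/

/-- Move the contents of `k` onto both `l` and `l'`. -/
def moveTwice (k l l' : Stack) : Prog := loop k fun a => seq (push l a) (push l' a)

theorem within_moveTwice {k l l' : Stack} (h1 : k ≠ l) (h2 : k ≠ l') (h3 : l ≠ l') (s : Store) :
    Within (moveTwice k l l') s (update (update (update s l ((s k).reverse ++ s l)) l'
      ((s k).reverse ++ s l')) k []) (3 * (s k).length + 1) := by
  generalize hw : s k = w
  induction w generalizing s with
  | nil =>
    refine (Within.loop_nil hw).congr ?_ (by simp)
    funext j
    simp only [update_apply]
    grind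
  | cons a w ih =>
    refine (Within.loop_cons hw (.seq (.push _ _ _) (.push _ _ _))
      (ih _ (by simp [h1, h2]))).congr ?_ ?_
    · funext j
      simp only [update_apply]
      grind
    · simp
      lia

/-- The stacks used in the computation of an output payoff are empty. -/
structure Idle (s : Store) : Prop extends Ready s where
  pos : s pos = []
  neg : s neg = []
  den : s den = []
  tab' : s tab' = []

theorem Idle.update_of {s : Store} (hs : Idle s) {k : Stack} (hk : k = inp ∨ k = out ∨ k = flag ∨
    k = pow ∨ k = tab) (w : List Γ') : Idle (update s k w) := by
  obtain ⟨⟨h1, h2, h3, h4, h5⟩, h6, h7, h8, h9⟩ := hs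
  obtain rfl | rfl | rfl | rfl | rfl := hk <;>
    exact ⟨⟨by simpa [Clean] using h1, by simpa, by simpa, by simpa, by simpa⟩, by simpa, by simpa,
      by simpa, by simpa⟩

/-- Emit the sum of the fractions of the text on `tab`, with the given coefficients. -/
def emitSum (ws : List ℚ≥0) : Prog :=
  seq (move tab tmp₁) (seq (moveTwice tmp₁ tab tab') (seq (push den (.bit true))
    (seq (accumulateList ws) (seq absDiff (seq (move pos out) (seq (push out .comma)
      (seq (move den out) (push out .comma))))))))

theorem within_emitSum (ws : List ℚ≥0) : ∃ C, ∀ (L : ℕ) (qs : List Frac) (s : Store),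
    qs.length = ws.length → (qs.flatMap Enc.frac).length ≤ L → Idle s →
    s tab = qs.flatMap Enc.frac →
    Within (emitSum ws) s (update s out ((Enc.frac (sumFrac ws qs)).reverse ++ s out))
      (C * (L + 1) ^ 2) := by
  obtain ⟨C, hC⟩ := within_accumulateList ws
  refine ⟨4 * C + 36 * (C + 1) + 60, fun L qs s hqs hL hs ht => ?_⟩
  obtain ⟨⟨⟨h1, h2, h3⟩, h4, h5, h6, h7⟩, h8, h9, h10, h11⟩ := hs
  obtain ⟨hb, w3⟩ := hC L 1 qs ⟨0, 0, 1⟩ [] (update (update s tab' (qs.flatMap Enc.frac))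
    den (nb 1)) hqs hL (by constructor <;> simpa [Clean] using by trivial)
    ⟨by simp, by simp, by simp⟩ (by simp) (by simpa) (by simpa) (by simp)
  set A := (Acc.mk 0 0 1).sum ws qs with hAdef
  have w4 := within_absDiff (a := A.pos) (b := A.neg) (N := 1 + C * (L + 1))
    (s := update (update (update s pos (nb A.pos)) neg (nb A.neg)) den (nb A.den))
    (by simpa [Clean] using ⟨h1, h2, h3⟩) (by simpa) (by simpa) hb.pos hb.neg (by simp) (by simp)
  refine ((within_move (by decide) _).seq ((within_moveTwice (by decide) (by decide) (by decide) _).seq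
    ((Within.push _ _ _).seq ((w3.of_eq ?_).seq ((w4.of_eq ?_).seq
    ((within_move (by decide) _).seq ((Within.push _ _ _).seq
    ((within_move (by decide) _).seq (Within.push _ _ _))))))))).congr ?_ ?_
  · funext j
    simp only [update_apply]
    grind [List.reverse_reverse, nb_one]
  · funext j
    simp only [update_apply]
    grind
  · have e : (Enc.frac (sumFrac ws qs)).reverse = .comma :: ((nb A.den).reverse ++
        .comma :: ((nb ((A.pos : ℤ) - A.neg).natAbs).reverse ++ [.bit (decide (A.pos < A.neg))])) := by
      simp [Enc.frac, sumFrac, enc_nat_eq, ← hAdef]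
    rw [e]
    funext j
    simp only [update_apply]
    grind
  · have l1 : (nb ((A.pos : ℤ) - A.neg).natAbs).length ≤ 1 + C * (L + 1) :=
      length_nb_le (lt_of_le_of_lt (b := max A.pos A.neg) (by lia)
        (max_lt hb.pos hb.neg))
    have l2 := length_nb_le hb.den
    have l3 : (1 + L + 1) ^ 2 ≤ 4 * (L + 1) ^ 2 := by nlinarith
    have l4 := Nat.mul_le_mul_left C l3
    have l5 := Nat.le_self_pow two_ne_zero (L + 1)
    have l6 := Nat.mul_le_mul_left C l5
    have l7 : (4 * C + 36 * (C + 1) + 60) * (L + 1) ^ 2 =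
        C * (4 * (L + 1) ^ 2) + 36 * (C * (L + 1) ^ 2) + 96 * (L + 1) ^ 2 := by ring
    rw [l7]
    generalize C * (4 * (L + 1) ^ 2) = Z₁ at *
    generalize C * (L + 1) ^ 2 = Z₂ at *
    generalize C * (1 + L + 1) ^ 2 = Z₃ at *
    generalize C * (L + 1) = Z₄ at *
    generalize (L + 1) ^ 2 = Z₅ at *
    simp [ht, h2, -List.length_flatMap]
    lia

/-- The fraction `-2 ^ L`. -/
def negPow (L : ℕ) : Frac := ⟨-2 ^ L, 1, one_pos⟩

/-- Emit the fraction `-2 ^ L`, where `L` is the height of the stack `pow`. -/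
def emitNegPow : Prog :=
  seq (push out (.bit true)) (seq (moveTwice pow out tmp₁) (seq (move tmp₁ pow)
    (load out [.comma, .bit true, .comma, .bit true])))

/-- The number `2 ^ L` is written as a one with `L` zeros below it. -/
theorem within_emitNegPow {L : ℕ} {s : Store} (hs : Idle s)
    (hp : s pow = List.replicate L (.bit false)) :
    Within emitNegPow s (update s out ((Enc.frac (negPow L)).reverse ++ s out)) (5 * L + 8) := by
  obtain ⟨⟨⟨h1, h2, h3⟩, h4, h5, h6, h7⟩, h8, h9, h10, h11⟩ := hs
  refine ((Within.push _ _ _).seq ((within_moveTwice (by decide) (by decide) (by decide) _).seq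
    ((within_move (by decide) _).seq (within_load _ _ _)))).congr ?_ ?_
  · have e : (Enc.frac (negPow L)).reverse = [.comma, .bit true, .comma, .bit true] ++
        (List.replicate L (.bit false) ++ [.bit true]) := by
      have : ((-2 ^ L : ℤ)).natAbs = 2 ^ L := by simp [Int.natAbs_pow]
      simp [Enc.frac, negPow, enc_nat_eq, this, nb_two_pow]
    rw [e]
    funext j
    simp only [update_apply, hp]
    grind [List.reverse_replicate]
  · simp [hp, h2]
    lia

/-- A row of the linear map that computes the new output payoffs: the coefficients of a payoff, or
`none` for the payoff `-2 ^ L`. -/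
abbrev Row := Option (List ℚ≥0)

/-- The new output payoff given by a row. -/
def rowFrac (L : ℕ) (qs : List Frac) : Row → Frac
  | none => negPow L
  | some ws => sumFrac ws qs

/-- Emit the new output payoffs for the rows of the linear map. -/
def emitRows : List Row → Prog
  | [] => skip
  | none :: rows => seq emitNegPow (emitRows rows)
  | some ws :: rows => seq (emitSum ws) (emitRows rows)

theorem within_emitRows (m : ℕ) (rows : List Row) (hr : ∀ ws, some ws ∈ rows → ws.length = m) :
    ∃ C, ∀ (L : ℕ) (qs : List Frac) (s : Store), qs.length = m →
    (qs.flatMap Enc.frac).length ≤ L → Idle s → s tab = qs.flatMap Enc.frac →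
    s pow = List.replicate L (.bit false) →
    Within (emitRows rows) s
      (update s out (((rows.map (rowFrac L qs)).flatMap Enc.frac).reverse ++ s out))
      (C * (L + 1) ^ 2) := by
  induction rows with
  | nil =>
    refine ⟨1, fun L qs s _ _ _ _ _ => (Within.skip s).congr (by simp) ?_⟩
    rw [one_mul]
    exact Nat.one_le_pow _ _ (by lia)
  | cons row rows ih =>
    obtain ⟨C, hC⟩ := ih fun ws hws => hr ws (List.mem_cons_of_mem _ hws)
    obtain _ | ws := row
    · refine ⟨C + 8, fun L qs s hqs hL hs ht hp => ?_⟩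
      refine ((within_emitNegPow hs hp).seq (hC L qs _ hqs hL (hs.update_of (by simp) _) (by simpa)
        (by simpa))).congr ?_ ?_
      · simp [rowFrac]
      · nlinarith
    · obtain ⟨C', hC'⟩ := within_emitSum ws
      refine ⟨C + C', fun L qs s hqs hL hs ht hp => ?_⟩
      refine ((hC' L qs s (by rw [hqs, hr ws (by simp)]) hL hs ht).seq
        (hC L qs _ hqs hL (hs.update_of (by simp) _) (by simpa) (by simpa))).congr ?_ ?_
      · simp [rowFrac]
      · rw [add_mul, add_comm]

/-! ### Processing an input word -/

/-- Move the symbols before the next closing bracket from `inp` onto `k`, and drop the bracket. -/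
def moveUntil (k : Stack) : Prog :=
  seq (push ctl .blank) (loop ctl fun _ => pop inp fun
    | none => skip
    | some .ket => skip
    | some a => seq (push k a) (push ctl .blank))

theorem within_moveUntil {k : Stack} (hk : k ≠ ctl) (hk' : k ≠ inp) {w r : List Γ'} {s : Store}
    (hc : s ctl = []) (hw : .ket ∉ w) (hi : s inp = w ++ .ket :: r) :
    Within (moveUntil k) s (update (update s inp r) k (w.reverse ++ s k)) (4 * w.length + 5) := by
  unfold moveUntil
  suffices H : ∀ s : Store, s ctl = [.blank] → s inp = w ++ .ket :: r →
      Within (loop ctl fun _ => pop inp fun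
        | none => skip
        | some .ket => skip
        | some a => seq (push k a) (push ctl .blank)) s
        (update (update (update s ctl []) inp r) k (w.reverse ++ s k)) (4 * w.length + 4) by
    refine (Within.seq (.push _ _ _) (H _ (by simp [hc]) (by simpa using hi))).congr ?_ (by lia)
    funext j
    simp only [update_apply]
    grind
  clear hc hi s
  induction w with
  | nil =>
    intro s hc hi
    refine (Within.loop_cons hc (.pop_cons (by simpa using hi) (.skip _))
      (.loop_nil (by simp))).congr ?_ (by simp)
    funext j
    simp only [update_apply]
    grind
  | cons a w ih =>
    intro s hc hi
    have ha : a ≠ .ket := fun h => hw (by simp [h])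
    refine (Within.loop_cons hc (.pop_cons (a := a) (l := w ++ .ket :: r) (by simpa using hi)
      (T := 2) (s' := update (update (update (update s ctl []) inp (w ++ .ket :: r)) k (a :: s k))
        ctl [.blank]) ?_)
      (ih (fun h => hw (by simp [h])) _ (by simp) (by simp [hk'.symm]))).congr ?_ ?_
    · have : Within (seq (push k a) (push ctl .blank))
          (update (update s ctl []) inp (w ++ .ket :: r))
          (update (update (update (update s ctl []) inp (w ++ .ket :: r)) k (a :: s k))
            ctl [.blank]) 2 := by
        refine (Within.seq (.push _ _ _) (.push _ _ _)).congr ?_ le_rfl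
        funext j
        simp only [update_apply]
        grind
      cases a <;> first | exact this | exact absurd rfl ha
    · funext j
      simp only [update_apply]
      grind
    · simp
      lia

/-- The data that an input has for a variable in `U`: the size of the domain and the tables of the
payoff functions. -/
structure Item where
  dom : ℕ
  α : List Frac
  β : List Frac

/-- The word that presents the data of a variable in `U`. -/
def Item.text (x : Item) : List Γ' :=
  Enc.nat x.dom ++ Enc.list Enc.frac x.α ++ Enc.list Enc.frac x.β

/-- Replace the output payoffs, for given linear maps. -/
def Item.replace (rows : ℕ → List Row) (L : ℕ) (x : Item) : Item where
  dom := x.dom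
  α := x.α
  β := (rows x.dom).map (rowFrac L x.β)

theorem ket_notMem_flatMap_frac (l : List Frac) : Γ'.ket ∉ l.flatMap Enc.frac := by
  simp [Enc.frac, Enc.nat]

/-- Process the tables of a variable in `U`. -/
def tables (rows : List Row) : Prog :=
  seq (moveUntil out) (seq (push out .ket) (seq (pop inp fun _ => push out .bra)
    (seq (moveUntil tmp₁) (seq (move tmp₁ tab) (seq (emitRows rows)
      (seq (push out .ket) (clear tab)))))))

theorem within_tables (m : ℕ) (rows : List Row) (hr : ∀ ws, some ws ∈ rows → ws.length = m) :
    ∃ C, ∀ (L : ℕ) (αs qs : List Frac) (s : Store) (r : List Γ'), qs.length = m →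
    (αs.flatMap Enc.frac).length ≤ L → (qs.flatMap Enc.frac).length ≤ L → Idle s → s tab = [] →
    s pow = List.replicate L (.bit false) →
    s inp = Enc.list Enc.frac αs ++ (Enc.list Enc.frac qs ++ r) →
    Within (tables rows) s
      (update (update s inp r) out ((Enc.list Enc.frac αs ++
        Enc.list Enc.frac (rows.map (rowFrac L qs))).reverse ++ s out))
      (C * (L + 1) ^ 2) := by
  obtain ⟨C, hC⟩ := within_emitRows m rows hr
  refine ⟨C + 30, fun L αs qs s r hqs hLα hLq hs ht hp hi => ?_⟩
  obtain ⟨⟨⟨h1, h2, h3⟩, h4, h5, h6, h7⟩, h8, h9, h10, h11⟩ := id hs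
  have w1 := within_moveUntil (k := out) (by decide) (by decide)
    (w := .bra :: αs.flatMap Enc.frac) (r := Enc.list Enc.frac qs ++ r) h1
    (by simpa using ket_notMem_flatMap_frac αs) (by simpa [Enc.list] using hi)
  have w2 := within_moveUntil (k := tmp₁) (by decide) (by decide) (w := qs.flatMap Enc.frac)
    (r := r) (s := update (update s inp (qs.flatMap Enc.frac ++ .ket :: r)) out
      (.bra :: .ket :: ((.bra :: αs.flatMap Enc.frac).reverse ++ s out))) (by simpa)
    (ket_notMem_flatMap_frac qs) (by simp)
  have w3 := hC L qs (update (update (update s inp r) out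
      (.bra :: .ket :: ((.bra :: αs.flatMap Enc.frac).reverse ++ s out))) tab
      (qs.flatMap Enc.frac)) hqs hLq
      (((hs.update_of (by simp) _).update_of (by simp) _).update_of (by simp) _) (by simp)
      (by simpa)
  refine (w1.seq ((Within.push _ _ _).seq ((Within.pop_cons (a := .bra)
    (l := qs.flatMap Enc.frac ++ .ket :: r) (by simp [Enc.list])
    (.push _ _ _)).seq ((w2.of_eq ?_).seq ((within_move (by decide) _).seq ((w3.of_eq ?_).seq
    ((Within.push _ _ _).seq (within_clear _ _)))))))).congr ?_ ?_
  · funext j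
    simp only [update_apply]
    grind
  · funext j
    simp only [update_apply]
    grind [List.reverse_reverse]
  · have e : (Enc.list Enc.frac αs ++ Enc.list Enc.frac (rows.map (rowFrac L qs))).reverse =
        .ket :: (((rows.map (rowFrac L qs)).flatMap Enc.frac).reverse ++
          (.bra :: .ket :: (.bra :: αs.flatMap Enc.frac).reverse)) := by
      simp [Enc.list]
    rw [e]
    funext j
    simp only [update_apply]
    grind
  · have l5 := Nat.le_self_pow two_ne_zero (L + 1)
    rw [add_mul]
    generalize C * (L + 1) ^ 2 = Z₁ at *
    generalize (L + 1) ^ 2 = Z₅ at *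
    simp [h2, -List.length_flatMap]
    lia

/-- Copy a binary number, read symbol by symbol, from `inp` to `out`, remember in `flag` whether it
is zero, and continue with `cont` of its value. The arguments are a bound on the number of bits to
come, the bits read so far, and the symbol popped last. As the sizes of the domains are bounded,
this is a finite case distinction. -/
def readDom (cont : ℕ → Prog) : ℕ → List Bool → Option Γ' → Prog
  | n + 1, l, some (.bit b) =>
    seq (push out (.bit b)) (pop inp (readDom cont n (l ++ [b])))
  | _, l, some .comma =>
    seq (push out .comma) (seq (if l = [] then push flag .comma else skip)
      (cont (Computability.decodeNat l)))
  | _, _, _ => skip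

theorem within_readDom {cont : ℕ → Prog} {r : List Γ'} {s' : Store} {T : ℕ} (l : List Bool) :
    ∀ (n : ℕ) (l' : List Bool) (s : Store), l.length ≤ n →
    Within (cont (Computability.decodeNat (l' ++ l)))
      (update (update (update s inp r) out ((l.map Γ'.bit ++ [Γ'.comma]).reverse ++ s out)) flag
        (if l' ++ l = [] then .comma :: s flag else s flag)) s' T →
    Within (readDom cont n l' (l.map Γ'.bit ++ Γ'.comma :: r).head?)
      (update s inp (l.map Γ'.bit ++ Γ'.comma :: r).tail) s' (T + 2 * l.length + 2) := by
  induction l with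
  | nil =>
    intro n l' s hn h
    simp only [List.append_nil] at h
    have : Within (seq (push out .comma) (seq (if l' = [] then push flag .comma else skip)
        (cont (Computability.decodeNat l')))) (update s inp r) s' (T + 2) := by
      by_cases hl : l' = []
      · rw [if_pos hl] at h ⊢
        refine ((Within.push _ _ _).seq ((Within.push _ _ _).seq (h.of_eq ?_))).congr rfl (by lia)
        simp
      · rw [if_neg hl] at h ⊢
        refine ((Within.push _ _ _).seq ((Within.skip _).seq (h.of_eq ?_))).congr rfl (by lia)
        funext j
        simp [update_apply]
        grind
    cases n <;> simpa [readDom] using this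
  | cons b l ih =>
    intro n l' s hn h
    obtain _ | n := n
    · simp at hn
    have := ih n (l' ++ [b]) (update s out (.bit b :: s out)) (by simpa using hn)
      (by
        rw [List.append_assoc, List.singleton_append]
        refine h.of_eq ?_
        funext j
        simp [update_apply]
        grind)
    rw [List.map_cons, List.cons_append, List.head?_cons, List.tail_cons, readDom]
    refine ((Within.push _ _ _).seq (s₂ := s') (T₂ := T + 2 * l.length + 3) ?_).congr rfl
      (by simp; lia)
    obtain ⟨a, w, haw⟩ : ∃ a w, l.map Γ'.bit ++ Γ'.comma :: r = a :: w := by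
      cases l <;> simp
    rw [haw] at this ⊢
    refine (Within.pop_cons (a := a) (l := w) (by simp) (this.of_eq ?_)).congr rfl (by lia)
    funext j
    simp only [update_apply, List.tail_cons]
    grind

theorem count_zero_cons (n : ℕ) (l : List ℕ) (w : List Γ') :
    List.replicate (l.count 0) Γ'.comma ++ (if n = 0 then .comma :: w else w) =
      List.replicate ((n :: l).count 0) Γ'.comma ++ w := by
  by_cases h : n = 0
  · subst h
    simp [List.replicate_succ', List.append_assoc]
  · simp [h]

/-- Process the data of all the variables in `U`, up to the closing bracket. -/
def loopU (k : ℕ) (rows : ℕ → List Row) : Prog :=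
  seq (push ctl .blank) (loop ctl fun _ => pop inp fun o =>
    if o = some .ket then push out .ket
    else seq (readDom (fun n => tables (rows n)) k [] o) (push ctl .blank))

theorem length_encodeNat_le (n : ℕ) : (Computability.encodeNat n).length ≤ n := by
  have := length_nb_le (n := n) Nat.lt_two_pow_self
  simpa [nb] using this

/-- The data of a variable in `U` is as required: the size of the domain is at most `k`, there are
`m` output payoffs, and the tables take up at most `L` symbols. -/
structure Item.Valid (x : Item) (k : ℕ) (m : ℕ → ℕ) (L : ℕ) : Prop where
  dom : x.dom ≤ k
  length_β : x.β.length = m x.dom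
  text_α : (x.α.flatMap Enc.frac).length ≤ L
  text_β : (x.β.flatMap Enc.frac).length ≤ L

/-- Constants for the finitely many sizes of domains yield a common one. -/
theorem exists_uniform_bound {P : ℕ → ℕ → Prop} (h : ∀ n, ∃ C, P n C)
    (hP : ∀ n C C', C ≤ C' → P n C → P n C') (k : ℕ) : ∃ C, ∀ n ≤ k, P n C := by
  choose f hf using h
  exact ⟨∑ n ∈ Finset.range (k + 1), f n, fun n hn => hP n _ _
    (Finset.single_le_sum (f := f) (fun _ _ => Nat.zero_le _) (by simp; lia)) (hf n)⟩

theorem within_loopU (k : ℕ) (m : ℕ → ℕ) (rows : ℕ → List Row)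
    (hr : ∀ n, ∀ ws, some ws ∈ rows n → ws.length = m n) :
    ∃ C, ∀ (L : ℕ) (xs : List Item) (s : Store) (r : List Γ'),
    (∀ x ∈ xs, x.Valid k m L) → Idle s → s tab = [] →
    s pow = List.replicate L (.bit false) →
    s inp = xs.flatMap Item.text ++ .ket :: r →
    Within (loopU k rows) s
      (update (update (update s inp r) out
        ((xs.flatMap (fun x : Item => (x.replace rows L).text) ++ [Γ'.ket]).reverse ++ s out)) flag
        (List.replicate ((xs.map Item.dom).count 0) .comma ++ s flag))
      ((xs.length + 1) * (C * (L + 1) ^ 2)) := by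
  obtain ⟨C, hC⟩ := exists_uniform_bound (fun n => within_tables (m n) (rows n) (hr n))
    (fun n C C' hCC h => fun L αs qs s r h1 h2 h3 h4 h5 h6 h7 =>
      (h L αs qs s r h1 h2 h3 h4 h5 h6 h7).congr rfl (Nat.mul_le_mul_right _ hCC)) k
  refine ⟨C + 2 * k + 6, fun L xs s r hx hs ht hp hi => ?_⟩
  have hL : 1 ≤ (L + 1) ^ 2 := Nat.one_le_pow _ _ (by lia)
  unfold loopU
  suffices H : ∀ s : Store, Idle (update s ctl []) → s ctl = [.blank] → s tab = [] →
      s pow = List.replicate L (.bit false) → s inp = xs.flatMap Item.text ++ .ket :: r →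
      Within (loop ctl fun _ => pop inp fun o =>
        if o = some .ket then push out .ket
        else seq (readDom (fun n => tables (rows n)) k [] o) (push ctl .blank)) s
        (update (update (update (update s ctl []) inp r) out
          ((xs.flatMap (fun x : Item => (x.replace rows L).text) ++ [Γ'.ket]).reverse ++ s out)) flag
          (List.replicate ((xs.map Item.dom).count 0) .comma ++ s flag))
        (xs.length * ((C + 2 * k + 6) * (L + 1) ^ 2) + 4) by
    have hc := hs.clean.1
    refine (Within.seq (.push _ _ _) (H _ (by simpa [← hc] using hs) (by simp [hc])
      (by simpa) (by simpa) (by simpa))).congr ?_ ?_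
    · funext j
      simp only [update_apply]
      grind
    · nlinarith
  clear hi ht hp hs s
  induction xs with
  | nil =>
    intro s hs hc ht hp hi
    refine (Within.loop_cons hc (.pop_cons (by simpa using hi) (.push _ _ _))
      (.loop_nil (by simp))).congr ?_ (by simp)
    funext j
    simp [update_apply]
    grind
  | cons x xs ih =>
    intro s hs hc ht hp hi
    obtain ⟨hv1, hv2, hv3, hv4⟩ := hx x (by simp)
    have w1 := hC x.dom hv1 L x.α x.β (update (update (update (update s ctl [])
      inp (Enc.list Enc.frac x.α ++ (Enc.list Enc.frac x.β ++
        (xs.flatMap Item.text ++ .ket :: r))))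
      out ((Enc.nat x.dom).reverse ++ s out)) flag
        (if x.dom = 0 then .comma :: s flag else s flag)) (xs.flatMap Item.text ++ .ket :: r)
      hv2 hv3 hv4 (((hs.update_of (by simp) _).update_of (by simp) _).update_of (by simp) _)
      (by simpa) (by simpa) (by simp)
    have hdec : (Computability.encodeNat x.dom = []) = (x.dom = 0) := by
      have h1 := head?_nb_eq_none (n := x.dom)
      simp only [List.head?_eq_none_iff, nb, List.map_eq_nil_iff] at h1
      exact propext h1
    have w2 := within_readDom (cont := fun n => tables (rows n)) (Computability.encodeNat x.dom) k []
      (r := Enc.list Enc.frac x.α ++ (Enc.list Enc.frac x.β ++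
        (xs.flatMap Item.text ++ .ket :: r))) (update s ctl [])
      ((length_encodeNat_le _).trans hv1) (by
        simp only [List.nil_append, hdec, Computability.decode_encodeNat]
        refine w1.of_eq ?_
        funext j
        simp [update_apply, Enc.nat])
    have w3 := ih (fun y hy => hx y (by simp [hy])) (update (update (update (update s
      inp (xs.flatMap Item.text ++ .ket :: r))
      out ((x.replace rows L).text.reverse ++ s out)) flag
        (if x.dom = 0 then .comma :: s flag else s flag)) ctl [.blank])
      (by
        have := (((hs.update_of (k := inp) (by simp) (xs.flatMap Item.text ++ .ket :: r)).update_of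
          (k := out) (by simp) ((x.replace rows L).text.reverse ++ s out)).update_of
          (k := flag) (by simp) (if x.dom = 0 then .comma :: s flag else s flag))
        convert this using 1
        funext j
        simp only [update_apply]
        grind) (by simp) (by simpa) (by simpa) (by simp)
    obtain ⟨a, w, haw, hne⟩ : ∃ a w, (Computability.encodeNat x.dom).map Γ'.bit ++ Γ'.comma ::
        (Enc.list Enc.frac x.α ++ (Enc.list Enc.frac x.β ++
        (xs.flatMap Item.text ++ .ket :: r))) = a :: w ∧ a ≠ .ket := by
      cases Computability.encodeNat x.dom <;> simp
    rw [haw] at w2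
    have hi' : s inp = a :: w := by
      rw [hi, ← haw]
      simp [Item.text, Enc.nat]
    refine (Within.loop_cons hc (.pop_cons (a := a) (l := w) (by simpa) (s' := _) (T := _) (by
      rw [if_neg (by simpa using hne)]
      exact w2.seq (.push _ _ _))) (w3.of_eq ?_)).congr ?_ ?_
    · funext j
      simp only [update_apply, Item.text, Item.replace, List.reverse_append]
      grind
    · have e := count_zero_cons x.dom (xs.map Item.dom) (s flag)
      rw [List.map_cons, ← e]
      funext j
      simp only [update_apply, List.flatMap_cons, List.reverse_append]
      grind
    · have := (length_encodeNat_le x.dom).trans hv1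
      simp only [List.length_cons]
      nlinarith

/-- Copy the sizes of the domains of the variables in `V`, and remember in `flag` whether some of
them are zero. The stack `ctl` tells the start of a number (`blank`) from its inside (`comma`). -/
def loopV : Prog :=
  seq (push ctl .blank) (loop ctl fun c => pop inp fun
    | none => skip
    | some .ket => push out .ket
    | some .comma =>
      seq (push out .comma) (seq (if c = .blank then push flag .comma else skip) (push ctl .blank))
    | some a => seq (push out a) (push ctl .comma))

/-- The number of empty words in a sequence of words terminated by commas; the argument `c` is
`blank` at the start of a word. -/
def countEmpty : Γ' → List Γ' → ℕ
  | _, [] => 0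
  | c, .comma :: w => (if c = .blank then 1 else 0) + countEmpty .blank w
  | _, _ :: w => countEmpty .comma w

theorem countEmpty_flatMap_nat (ns : List ℕ) :
    countEmpty .blank (ns.flatMap Enc.nat) = ns.count 0 := by
  have aux (l : List Bool) (w : List Γ') :
      countEmpty .comma (l.map .bit ++ .comma :: w) = countEmpty .blank w := by
    induction l with
    | nil => simp [countEmpty]
    | cons b l ih => simpa [countEmpty] using ih
  induction ns with
  | nil => rfl
  | cons n ns ih =>
    rw [List.flatMap_cons, enc_nat_eq]
    by_cases hn : n = 0
    · subst hn
      simp [countEmpty, ih, add_comm]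
    · have := aux (Computability.encodeNat (n / 2)) (ns.flatMap Enc.nat)
      simp [nb_of_ne_zero hn, hn, ← ih]
      simpa [countEmpty, nb] using this

/-- The symbols put onto `flag` count the empty domains; these are the zeros, encoded by empty
words. -/
theorem within_loopV {w r : List Γ'} {s : Store} (hw : .ket ∉ w) (hs : s ctl = [])
    (hi : s inp = w ++ .ket :: r) :
    Within loopV s
      (update (update (update s inp r) out ((w ++ [Γ'.ket]).reverse ++ s out)) flag
        (List.replicate (countEmpty .blank w) .comma ++ s flag)) (5 * w.length + 5) := by
  unfold loopV
  suffices H : ∀ (c : Γ') (s : Store), s ctl = [c] → s inp = w ++ .ket :: r →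
      Within (loop ctl fun c => pop inp fun
        | none => skip
        | some .ket => push out .ket
        | some .comma => seq (push out .comma)
          (seq (if c = .blank then push flag .comma else skip) (push ctl .blank))
        | some a => seq (push out a) (push ctl .comma)) s
        (update (update (update (update s ctl []) inp r) out ((w ++ [Γ'.ket]).reverse ++ s out)) flag
        (List.replicate (countEmpty c w) .comma ++ s flag)) (5 * w.length + 4) by
    refine (Within.seq (.push _ _ _) (H .blank _ (by simp [hs]) (by simpa))).congr ?_ (by lia)
    funext j
    simp only [update_apply]
    grind
  clear hi hs s
  induction w with
  | nil =>
    intro c s hc hi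
    refine (Within.loop_cons hc (.pop_cons (by simpa using hi) (.push _ _ _))
      (.loop_nil (by simp))).congr ?_ (by simp)
    funext j
    simp [update_apply, countEmpty]
    grind
  | cons a w ih =>
    intro c s hc hi
    have ha : a ≠ .ket := fun h => hw (by simp [h])
    have ih' := ih fun h => hw (by simp [h])
    by_cases hcomma : a = .comma
    · subst hcomma
      by_cases hb : c = .blank
      · subst hb
        refine (Within.loop_cons hc (.pop_cons (a := .comma) (l := w ++ .ket :: r) (by simpa using hi)
          (.seq (.push _ _ _) (.seq (.push _ _ _) (.push _ _ _))))
          (ih' .blank _ (by simp) (by simp))).congr ?_ ?_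
        · have e : List.replicate (countEmpty .blank (.comma :: w)) Γ'.comma ++ s flag =
              List.replicate (countEmpty .blank w) Γ'.comma ++ .comma :: s flag := by
            simp [countEmpty, add_comm 1, List.replicate_succ', List.append_assoc]
          rw [e]
          funext j
          simp only [update_apply]
          grind
        · simp
          lia
      · refine (Within.loop_cons hc (.pop_cons (a := .comma) (l := w ++ .ket :: r)
          (by simpa using hi) (T := 3) (s' := update (update (update (update s ctl [])
          inp (w ++ .ket :: r)) out (.comma :: s out)) ctl [.blank]) (by
            simp only [if_neg hb]
            refine (Within.seq (.push _ _ _) (.seq (.skip _) (.push _ _ _))).congr ?_ le_rfl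
            funext j
            simp only [update_apply]
            grind)) (ih' .blank _ (by simp) (by simp))).congr ?_ ?_
        · have e : countEmpty c (.comma :: w) = countEmpty .blank w := by simp [countEmpty, hb]
          rw [e]
          funext j
          simp only [update_apply]
          grind
        · simp
          lia
    · have : Within (seq (push out a) (push ctl .comma))
          (update (update s ctl []) inp (w ++ .ket :: r))
          (update (update (update (update s ctl []) inp (w ++ .ket :: r)) out (a :: s out))
            ctl [.comma]) 2 := by
        refine (Within.seq (.push _ _ _) (.push _ _ _)).congr ?_ le_rfl
        funext j
        simp only [update_apply]
        grind
      have e : countEmpty c (a :: w) = countEmpty .comma w := by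
        cases a <;> first | exact absurd rfl hcomma | simp [countEmpty]
      refine (Within.loop_cons hc (.pop_cons (a := a) (l := w ++ .ket :: r) (by simpa using hi)
        (T := 2) (s' := update (update (update (update s ctl []) inp (w ++ .ket :: r))
        out (a :: s out)) ctl [.comma]) ?_)
        (ih' .comma _ (by simp) (by simp))).congr ?_ ?_
      · cases a <;> first | exact this | exact absurd rfl ha | exact absurd rfl hcomma
      · rw [e]
        funext j
        simp only [update_apply]
        grind
      · simp
        lia

/-! ### The whole transformation -/

/-- Put as many zeros onto `pow` as the input word has symbols. -/
def measure : Prog :=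
  seq (loop inp fun a => seq (push tmp₁ a) (push pow (.bit false))) (move tmp₁ inp)

theorem within_measure {s : Store} (hp : s pow = []) (ht : s tmp₁ = []) :
    Within measure s (update s pow (List.replicate (s inp).length (.bit false)))
      (5 * (s inp).length + 2) := by
  have H : ∀ (w : List Γ') (s : Store), s inp = w →
      Within (loop inp fun a => seq (push tmp₁ a) (push pow (.bit false))) s
        (update (update (update s inp []) tmp₁ (w.reverse ++ s tmp₁)) pow
          (List.replicate w.length (.bit false) ++ s pow)) (3 * w.length + 1) := by
    intro w
    induction w with
    | nil =>
      intro s hi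
      refine (Within.loop_nil hi).congr ?_ (by simp)
      funext j
      simp [update_apply]
      grind
    | cons a w ih =>
      intro s hi
      refine (Within.loop_cons hi (.seq (.push _ _ _) (.push _ _ _)) (ih _ (by simp))).congr ?_ ?_
      · have e : List.replicate (a :: w).length (Γ'.bit false) ++ s pow =
            List.replicate w.length (Γ'.bit false) ++ .bit false :: s pow := by
          simp [List.replicate_succ', List.append_assoc]
        rw [e]
        funext j
        simp only [update_apply]
        grind
      · simp
        lia
  refine ((H _ s rfl).seq (within_move (by decide) _)).congr ?_ ?_
  · funext j
    simp only [update_apply]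
    grind [List.reverse_reverse]
  · simp [ht]
    lia

/-- Replace the output by the fixed word `w` if some domain is empty, and move it to `inp`. -/
def finish (w : List Γ') : Prog :=
  seq (clear pow) (seq (pop flag fun
    | none => skip
    | some _ => seq (clear flag) (seq (clear out) (load out w.reverse))) (move out inp))

theorem within_finish (w : List Γ') {s : Store} (hi : s inp = []) :
    Within (finish w) s
      (update (update (update (update s pow []) flag []) out []) inp
        (if s flag = [] then (s out).reverse else w))
      (2 * (s pow).length + 2 * (s flag).length + 4 * (s out).length + 3 * w.length + 8) := by
  by_cases hf : s flag = []
  · refine ((within_clear _ _).seq ((Within.pop_nil (by simpa) (.skip _)).seq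
      (within_move (by decide) _))).congr ?_ ?_
    · funext j
      simp only [update_apply]
      grind
    · simp [hf]
      lia
  · obtain ⟨a, l, hl⟩ := List.exists_cons_of_ne_nil hf
    refine ((within_clear _ _).seq ((Within.pop_cons (a := a) (l := l) (by simpa)
      ((within_clear _ _).seq ((within_clear _ _).seq (within_load _ _ _)))).seq
      (within_move (by decide) _))).congr ?_ ?_
    · rw [if_neg hf]
      funext j
      simp only [update_apply]
      grind [List.reverse_reverse]
    · simp [hl]
      lia

/-- Write the input word with replaced output payoffs onto `out`, in reverse. -/
def process (k : ℕ) (rows : ℕ → List Row) : Prog :=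
  seq measure (seq (pop inp fun _ => push out .bra) (seq (loopU k rows)
    (seq (pop inp fun _ => push out .bra) (seq loopV (move inp out)))))

/-- An input word: the data of the variables in `U`, the sizes of the domains of the variables in
`V`, and a remaining part. -/
def inputWord (xs : List Item) (ns : List ℕ) (r : List Γ') : List Γ' :=
  Enc.list Item.text xs ++ Enc.list Enc.nat ns ++ r

theorem length_flatMap_le {X : Type} (f : X → List Γ') {l : List X} {x : X} (hx : x ∈ l) :
    (f x).length ≤ (l.flatMap f).length := by
  rw [List.length_flatMap]
  exact List.le_sum_of_mem (List.mem_map_of_mem hx)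

theorem length_le_length_flatMap {X : Type} (f : X → List Γ') (hf : ∀ x, f x ≠ []) (l : List X) :
    l.length ≤ (l.flatMap f).length := by
  induction l with
  | nil => simp
  | cons x l ih =>
    have := List.length_pos_of_ne_nil (hf x)
    rw [List.flatMap_cons, List.length_append, List.length_cons]
    lia

/-- A program puts at most one symbol onto a stack in every step. -/
theorem Runs.length_le {p : Prog} {s s' : Store} {t : ℕ} (h : Runs p s s' t) (j : Stack) :
    (s' j).length ≤ (s j).length + t := by
  have aux (s : Store) (k : Stack) (w : List Γ') :
      (update s k w j).length ≤ max (s j).length (if j = k then w.length else 0) := by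
    by_cases hj : j = k
    · subst hj
      simp
    · simp [hj]
  induction h with
  | skip s => lia
  | push k a s =>
    have := aux s k (a :: s k)
    split_ifs at this with hj
    · subst hj
      simp at this ⊢
    · lia
  | @pop k f s s' t h ih =>
    have := aux s k (s k).tail
    split_ifs at this with hj
    · subst hj
      simp at this ih
      lia
    · lia
  | seq h₁ h₂ ih₁ ih₂ => lia
  | loop_nil h => lia
  | @loop_cons k f s s₁ s₂ a l t₁ t₂ hk h₁ h₂ ih₁ ih₂ =>
    have := aux s k l
    split_ifs at this with hj
    · subst hj
      simp [hk] at this ih₁ ⊢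
      lia
    · lia

theorem Within.length_le {p : Prog} {s s' : Store} {T : ℕ} (h : Within p s s' T) (j : Stack) :
    (s' j).length ≤ (s j).length + T := by
  obtain ⟨t, ht, hr⟩ := h
  exact (hr.length_le j).trans (by lia)

theorem ket_notMem_flatMap_nat (l : List ℕ) : Γ'.ket ∉ l.flatMap Enc.nat := by
  simp [Enc.nat]

theorem within_process (k : ℕ) (m : ℕ → ℕ) (rows : ℕ → List Row)
    (hr : ∀ n, ∀ ws, some ws ∈ rows n → ws.length = m n) :
    ∃ C, ∀ (xs : List Item) (ns : List ℕ) (r : List Γ') (L : ℕ),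
    (∀ x ∈ xs, x.dom ≤ k ∧ x.β.length = m x.dom) → (inputWord xs ns r).length = L →
    Within (process k rows) (wordStore (inputWord xs ns r))
      (update (update (update (fun _ => []) pow (List.replicate L (.bit false))) flag
        (List.replicate (ns.count 0) .comma ++ List.replicate ((xs.map Item.dom).count 0) .comma))
        out (inputWord (xs.map (Item.replace rows L)) ns r).reverse)
      (C * (L + 1) ^ 3) := by
  obtain ⟨C, hC⟩ := within_loopU k m rows hr
  refine ⟨C + 20, fun xs ns r L hx hLdef => ?_⟩
  have hL : L = (xs.flatMap Item.text).length + (ns.flatMap Enc.nat).length + r.length + 4 := by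
    simp [← hLdef, inputWord, Enc.list, -List.length_flatMap]
    lia
  have hxs : xs.length ≤ L :=
    (length_le_length_flatMap Item.text (fun x => by simp [Item.text, Enc.nat]) xs).trans (by lia)
  have hval : ∀ x ∈ xs, x.Valid k m L := by
    intro x hxm
    have h1 := length_flatMap_le Item.text hxm
    simp only [Item.text, Enc.list, List.length_append, List.length_cons] at h1
    exact ⟨(hx x hxm).1, (hx x hxm).2, by lia, by lia⟩
  set newU := xs.flatMap (fun x : Item => (x.replace rows L).text) with hnewU
  have hbase : Idle (fun _ => []) := by constructor <;> (try constructor) <;> simp [Clean]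
  have w1 := within_measure (s := wordStore (inputWord xs ns r)) rfl rfl
  have hinp : wordStore (inputWord xs ns r) inp = .bra :: (xs.flatMap Item.text ++
      .ket :: (.bra :: (ns.flatMap Enc.nat ++ .ket :: r))) := by
    simp [wordStore, inputWord, Enc.list]
  have w2 := hC L xs (update (update (update (fun _ => []) pow (List.replicate L (.bit false)))
    inp (xs.flatMap Item.text ++ .ket :: (.bra :: (ns.flatMap Enc.nat ++ .ket :: r))))
    out [.bra]) (.bra :: (ns.flatMap Enc.nat ++ .ket :: r)) hval
    (((hbase.update_of (by simp) _).update_of (by simp) _).update_of (by simp) _) (by simp)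
    (by simp) (by simp)
  have w3 := within_loopV (w := ns.flatMap Enc.nat) (r := r) (s := update (update (update (update
    (fun _ => []) pow (List.replicate L (.bit false))) flag
      (List.replicate ((xs.map Item.dom).count 0) Γ'.comma)) inp (ns.flatMap Enc.nat ++ .ket :: r))
      out (.bra :: .ket :: (newU.reverse ++ [.bra]))) (ket_notMem_flatMap_nat ns) (by simp) (by simp)
  refine (w1.seq ((Within.pop_cons (k := inp) (a := .bra)
    (l := xs.flatMap Item.text ++ .ket :: (.bra :: (ns.flatMap Enc.nat ++ .ket :: r))) ?_
    (.push _ _ _)).seq ((w2.of_eq ?_).seq ((Within.pop_cons (k := inp) (a := .bra)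
        (l := ns.flatMap Enc.nat ++ .ket :: r) ?_ (.push _ _ _)).seq
      ((w3.of_eq ?_).seq (within_move (k := inp) (l := out) (by decide) _)))))).congr ?_ ?_
  · rw [update_of_ne (by decide), hinp]
  · rw [show (wordStore (inputWord xs ns r) inp).length = L from hLdef]
    funext j
    simp only [update_apply, wordStore]
    grind
  · simp
  · funext j
    simp only [update_apply, List.reverse_append, ← hnewU]
    grind
  · have hO : (inputWord (xs.map (Item.replace rows L)) ns r).reverse =
        r.reverse ++ ((ns.flatMap Enc.nat ++ [Γ'.ket]).reverse ++
          (.bra :: .ket :: (newU.reverse ++ [.bra]))) := by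
      simp [inputWord, hnewU, Enc.list, List.flatMap_map]
    rw [hO, countEmpty_flatMap_nat]
    funext j
    simp only [update_apply]
    grind
  · have h1 : (xs.length + 1) * (C * (L + 1) ^ 2) ≤ (L + 1) * (C * (L + 1) ^ 2) := by gcongr
    have h2 : (C + 20) * (L + 1) ^ 3 = (L + 1) * (C * (L + 1) ^ 2) + 20 * (L + 1) ^ 3 := by ring
    have h3 := Nat.le_self_pow three_ne_zero (L + 1)
    have h4 : (wordStore (inputWord xs ns r) inp).length = L := hLdef
    rw [h2]
    generalize (L + 1) * (C * (L + 1) ^ 2) = Z at *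
    generalize (xs.length + 1) * (C * (L + 1) ^ 2) = Z' at *
    generalize (L + 1) ^ 3 = Z'' at *
    simp [h4, -List.length_flatMap]
    lia

/-- The program that replaces the output payoffs in an input word, and yields the fixed word `w` if
some domain is empty. -/
def replaceProg (k : ℕ) (rows : ℕ → List Row) (w : List Γ') : Prog :=
  seq (process k rows) (finish w)

/-- The transformation of words takes cubic time: there are at most `L` variables, and each is
processed in quadratic time. -/
theorem within_replaceProg (k : ℕ) (m : ℕ → ℕ) (rows : ℕ → List Row) (w : List Γ')
    (hr : ∀ n, ∀ ws, some ws ∈ rows n → ws.length = m n) :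
    ∃ C, ∀ (xs : List Item) (ns : List ℕ) (r : List Γ') (L : ℕ),
    (∀ x ∈ xs, x.dom ≤ k ∧ x.β.length = m x.dom) → (inputWord xs ns r).length = L →
    Within (replaceProg k rows w) (wordStore (inputWord xs ns r))
      (wordStore (if 0 ∈ xs.map Item.dom ∨ 0 ∈ ns then w
        else inputWord (xs.map (Item.replace rows L)) ns r))
      (C * (L + 1) ^ 3) := by
  obtain ⟨C, hC⟩ := within_process k m rows hr
  refine ⟨9 * C + 3 * w.length + 10, fun xs ns r L hx hL => ?_⟩
  have w1 := hC xs ns r L hx hL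
  refine (w1.seq (within_finish w (by simp))).congr ?_ ?_
  · have h : (List.replicate (ns.count 0) Γ'.comma ++
        List.replicate ((xs.map Item.dom).count 0) Γ'.comma = []) ↔
        ¬ (0 ∈ xs.map Item.dom ∨ 0 ∈ ns) := by
      simp only [List.append_eq_nil_iff, List.replicate_eq_nil_iff, List.count_eq_zero]
      tauto
    funext j
    simp only [update_apply, wordStore]
    grind [List.reverse_reverse]
  · -- the stacks `pow`, `flag` and `out` are at most as high as the number of steps so far
    have h1 := w1.length_le pow
    have h2 := w1.length_le flag
    have h3 := w1.length_le out
    have e1 : wordStore (inputWord xs ns r) pow = [] := rfl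
    have e2 : wordStore (inputWord xs ns r) flag = [] := rfl
    have e3 : wordStore (inputWord xs ns r) out = [] := rfl
    rw [e1, List.length_nil, zero_add] at h1
    rw [e2, List.length_nil, zero_add] at h2
    rw [e3, List.length_nil, zero_add] at h3
    have h4 : 1 ≤ (L + 1) ^ 3 := Nat.one_le_pow _ _ (by lia)
    have h5 := Nat.mul_le_mul_left w.length h4
    have h6 : (9 * C + 3 * w.length + 10) * (L + 1) ^ 3 = 9 * (C * (L + 1) ^ 3) +
      3 * (w.length * (L + 1) ^ 3) + 10 * (L + 1) ^ 3 := by ring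
    rw [h6]
    generalize C * (L + 1) ^ 3 = Z at *
    generalize w.length * (L + 1) ^ 3 = Z' at *
    generalize (L + 1) ^ 3 = Z'' at *
    lia

end StackProg

/-! ### Expected values -/

namespace RatDist

variable {X Y : Type*}

theorem expect_map (μ : RatDist X) (f : X → Y) (φ : Y → ℚ) :
    (μ.map f).expect φ = μ.expect fun x => φ (f x) :=
  Finsupp.sum_mapDomain_index (fun _ => by simp) fun _ _ _ => by push_cast; ring

theorem expect_bind (μ : RatDist X) (F : X → RatDist Y) (φ : Y → ℚ) :
    (μ.bind F).expect φ = μ.expect fun x => (F x).expect φ := by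
  unfold expect bind
  rw [Finsupp.sum_sum_index (fun _ => by simp) fun _ _ _ => by push_cast; ring]
  refine Finset.sum_congr rfl fun x _ => ?_
  change ((μ.weight x • (F x).weight).sum fun y q => (q : ℚ) * φ y) = _
  rw [Finsupp.sum_smul_index fun _ => by simp]
  refine Eq.trans ?_ (Finsupp.mul_sum _ _).symm
  refine Finset.sum_congr rfl fun y _ => ?_
  push_cast
  ring

theorem expect_restrict (μ : RatDist X) (S : Set X) (h : μ.supp ⊆ S) (φ : X → ℚ) :
    (μ.restrict S h).expect (fun x => φ x) = μ.expect φ :=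
  Finsupp.sum_subtypeDomain_index (p := fun x => x ∈ S) (h := fun x (q : ℚ≥0) => (q : ℚ) * φ x)
    fun _ hx => h (pos_iff_ne_zero.mpr (Finsupp.mem_support_iff.mp hx))

theorem expect_comm (μ : RatDist X) (ν : RatDist Y) (φ : X → Y → ℚ) :
    (μ.expect fun x => ν.expect fun y => φ x y) = ν.expect fun y => μ.expect fun x => φ x y := by
  unfold expect Finsupp.sum
  simp only [Finset.mul_sum]
  rw [Finset.sum_comm]
  refine Finset.sum_congr rfl fun y _ => Finset.sum_congr rfl fun x _ => ?_
  ring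

theorem sum_weight (μ : RatDist X) : (μ.weight.sum fun _ q => (q : ℚ)) = 1 := by
  have := congrArg ((↑) : ℚ≥0 → ℚ) μ.total
  simpa [Finsupp.sum, NNRat.cast_sum] using this

theorem expect_const (μ : RatDist X) (c : ℚ) : (μ.expect fun _ => c) = c := by
  rw [expect, ← Finsupp.sum_mul, sum_weight, one_mul]

theorem expect_sum {ι : Type*} (s : Finset ι) (μ : RatDist X) (φ : ι → X → ℚ) :
    (μ.expect fun x => ∑ i ∈ s, φ i x) = ∑ i ∈ s, μ.expect (φ i) := by
  unfold expect Finsupp.sum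
  simp only [Finset.mul_sum]
  exact Finset.sum_comm

theorem supp_nonempty (μ : RatDist X) : μ.supp.Nonempty := by
  by_contra h
  have h0 : μ.weight = 0 := by
    refine Finsupp.ext fun x => ?_
    by_contra hx
    exact h ⟨x, pos_iff_ne_zero.mpr hx⟩
  have := μ.total
  simp [h0] at this

/-- Some point is at least as good as the average. -/
theorem exists_expect_le (μ : RatDist X) (φ : X → ℚ) : ∃ x ∈ μ.supp, μ.expect φ ≤ φ x := by
  by_contra! h
  obtain ⟨x, hx⟩ := μ.supp_nonempty
  have hlt : μ.expect φ < μ.expect fun _ => μ.expect φ :=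
    Finset.sum_lt_sum (fun y hy => mul_le_mul_of_nonneg_left
      (h y (pos_iff_ne_zero.mpr (Finsupp.mem_support_iff.mp hy))).le (by positivity))
      ⟨x, Finsupp.mem_support_iff.mpr (pos_iff_ne_zero.mp hx),
        mul_lt_mul_of_pos_left (h x hx) (by exact_mod_cast hx)⟩
  rw [expect_const] at hlt
  exact lt_irrefl _ hlt

theorem expect_eq_sum_equiv {m : ℕ} (μ : RatDist X) (e : Fin m ≃ X) (φ : X → ℚ) :
    μ.expect φ = ∑ j, (μ.weight (e j) : ℚ) * φ (e j) := by
  have : Fintype X := .ofEquiv _ e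
  rw [expect, Finsupp.sum_fintype _ _ fun _ => by simp]
  exact (e.sum_comp fun x => (μ.weight x : ℚ) * φ x).symm

end RatDist

/-! ### The values of the computed fractions -/

namespace StackProg

theorem Acc.value_step (A : Acc) (hA : 0 < A.den) (w : ℚ≥0) (q : Frac) :
    (((A.step w.num w.den q).pos : ℚ) - (A.step w.num w.den q).neg) / (A.step w.num w.den q).den =
      ((A.pos : ℚ) - A.neg) / A.den + w * q.value := by
  have hq : (q.den : ℚ) ≠ 0 := by exact_mod_cast q.den_pos.ne'
  have hw : (w.den : ℚ) ≠ 0 := by exact_mod_cast w.den_pos.ne'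
  have hA' : (A.den : ℚ) ≠ 0 := by exact_mod_cast hA.ne'
  have hwv : (w : ℚ) = (w.num : ℚ) / w.den := by
    conv_lhs => rw [← NNRat.num_div_den w]
    push_cast
    rfl
  rw [hwv, Frac.value]
  by_cases hn : q.num < 0
  · have e : (q.num : ℚ) = -(q.num.natAbs : ℚ) := by
      rw [Nat.cast_natAbs, abs_of_neg hn]
      simp
    simp only [Acc.step, hn, if_true, e]
    push_cast
    field_simp
    ring
  · have e : (q.num : ℚ) = (q.num.natAbs : ℚ) := by
      rw [Nat.cast_natAbs, abs_of_nonneg (not_lt.mp hn)]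
    simp only [Acc.step, hn, if_false, e]
    push_cast
    field_simp
    ring

theorem Acc.value_sum (ws : List ℚ≥0) (qs : List Frac) (A : Acc) (hA : 0 < A.den) :
    (((A.sum ws qs).pos : ℚ) - (A.sum ws qs).neg) / (A.sum ws qs).den =
      ((A.pos : ℚ) - A.neg) / A.den +
        (List.zipWith (fun (w : ℚ≥0) q => (w : ℚ) * q.value) ws qs).sum := by
  induction ws generalizing qs A with
  | nil => simp [Acc.sum]
  | cons w ws ih =>
    cases qs with
    | nil => simp [Acc.sum]
    | cons q qs =>
      rw [Acc.sum, ih _ _ (Nat.mul_pos hA (Nat.mul_pos q.den_pos w.den_pos)), A.value_step hA]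
      simp [add_assoc]

theorem value_sumFrac (ws : List ℚ≥0) (qs : List Frac) : (sumFrac ws qs).value =
    (List.zipWith (fun (w : ℚ≥0) q => (w : ℚ) * q.value) ws qs).sum := by
  have := Acc.value_sum ws qs ⟨0, 0, 1⟩ one_pos
  simpa [Frac.value, sumFrac] using this

theorem value_sumFrac_ofFn {m : ℕ} (w : Fin m → ℚ≥0) (q : Fin m → Frac) :
    (sumFrac (List.ofFn w) (List.ofFn q)).value = ∑ j, (w j : ℚ) * (q j).value := by
  rw [value_sumFrac, ← List.sum_ofFn]
  congr 1
  refine List.ext_getElem (by simp) fun i h1 h2 => by simp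

theorem value_negPow (L : ℕ) : (negPow L).value = -2 ^ L := by
  simp [Frac.value, negPow]

end StackProg

namespace VMCInstance

open Computability (Γ')
open StackProg

/-! ### The word that presents an input -/

variable {M M' : Minion} {V : ValuedMinion M} {V' : ValuedMinion M'} {k : ℕ}

/-- The data of the variable `u`. -/
noncomputable def item (e : M.Enumeration) (I : VMCInstance V k) (u : Fin I.nU) : Item where
  dom := I.domU u
  α := List.ofFn (I.α u)
  β := List.ofFn fun i => I.β u (e (I.domU u) i)

/-- The word that presents the minor conditions. -/
def condsText (D : VMCData k) : List Γ' :=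
  Enc.list (fun c : MinorCondition D.domU D.domV =>
      Enc.nat c.u ++ Enc.nat c.v ++
        Enc.list (fun d : Fin (D.domU c.u) => Enc.nat (c.π d)) (List.finRange (D.domU c.u)))
    D.conds

theorem encode_eq (e : M.Enumeration) (I : VMCInstance V k) :
    I.encode e = inputWord ((List.finRange I.nU).map (I.item e))
      ((List.finRange I.nV).map I.domV) (condsText I.toVMCData) := by
  simp only [encode, inputWord, condsText, Enc.list, List.flatMap_map]
  rfl

/-- The encoding is long enough for `2 ^ L` to bound `|U|` times any output payoff, where `L` is
its length. -/
theorem mul_value_lt (e : M.Enumeration) (I : VMCInstance V k) (u : Fin I.nU)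
    (f : M.obj (Fin (I.domU u))) :
    (I.nU : ℚ) * (I.β u f).value < 2 ^ (I.encode e).length := by
  set q := I.β u f with hq
  have h1 : (Enc.frac q).length ≤ ((I.item e u).β.flatMap Enc.frac).length := by
    refine length_flatMap_le Enc.frac ?_
    simp only [item, List.mem_ofFn]
    exact ⟨(e (I.domU u)).symm f, by simp [hq]⟩
  have h2 : I.nU + (nb q.num.natAbs).length ≤ (I.encode e).length := by
    have h3 : ∀ l : List (Fin I.nU), u ∈ l →
        l.length + (nb q.num.natAbs).length ≤ (l.flatMap fun u => (I.item e u).text).length := by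
      intro l
      induction l with
      | nil => simp
      | cons v l ih =>
        intro hu
        have hv : 1 ≤ (I.item e v).text.length := by simp [Item.text, Enc.nat]; lia
        rw [List.flatMap_cons, List.length_append, List.length_cons]
        rcases List.mem_cons.mp hu with rfl | hu
        · have h4 := length_le_length_flatMap (fun u => (I.item e u).text)
            (fun u => by simp [Item.text, Enc.nat]) l
          have h5 : (nb q.num.natAbs).length + 3 ≤ (I.item e u).text.length := by
            rw [length_enc_frac] at h1
            simp only [Item.text, Enc.list, List.length_append, List.length_cons]
            lia
          lia
        · have := ih hu
          lia
    have h6 := h3 (List.finRange I.nU) (List.mem_finRange u)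
    rw [encode_eq, inputWord, Enc.list, List.flatMap_map]
    simp only [List.length_append, List.length_cons]
    rw [List.length_finRange] at h6
    lia
  have hnU : (I.nU : ℚ) < 2 ^ I.nU := by exact_mod_cast Nat.lt_two_pow_self
  have hnum : (q.num.natAbs : ℚ) < 2 ^ (nb q.num.natAbs).length := by
    exact_mod_cast lt_two_pow_length_nb _
  have hval : q.value ≤ q.num.natAbs := by
    rw [Frac.value, Nat.cast_natAbs]
    have hden : (1 : ℚ) ≤ q.den := by exact_mod_cast q.den_pos
    rw [div_le_iff₀ (by linarith)]
    calc (q.num : ℚ) ≤ |(q.num : ℚ)| := le_abs_self _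
      _ ≤ _ := by
        push_cast
        exact le_mul_of_one_le_right (abs_nonneg _) hden
  calc (I.nU : ℚ) * q.value ≤ I.nU * q.num.natAbs := by gcongr
    _ < 2 ^ I.nU * 2 ^ (nb q.num.natAbs).length :=
        mul_lt_mul'' hnU hnum (by positivity) (by positivity)
    _ = 2 ^ (I.nU + (nb q.num.natAbs).length) := (pow_add _ _ _).symm
    _ ≤ _ := pow_le_pow_right₀ (by norm_num) h2

/-! ### Inputs with an empty domain -/

/-- The fraction `-1`. -/
def negOne : Frac := ⟨-1, 1, one_pos⟩

/-- An input in which no assignment has nonnegative payoff. -/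
def noInstance (V : ValuedMinion M) (hk : 0 < k) : VMCInstance V k where
  nU := 1
  nV := 0
  domU _ := 1
  domV := Fin.elim0
  domU_le _ := hk
  domV_le v := v.elim0
  conds := []
  α _ _ := negOne
  β _ _ := negOne
  payoff := by
    intro Ω _ h
    simp only [RatDist.expect_const] at h
    norm_num [negOne, Frac.value] at h

theorem no_noInstance (V : ValuedMinion M) (hk : 0 < k) : (noInstance V hk).No := by
  rintro ⟨hU, hV, -, h⟩
  change 0 ≤ ∑ u : Fin 1, negOne.value at h
  norm_num [negOne, Frac.value] at h

theorem not_yes_of_not_domainsNonempty {I : VMCInstance V k} (h : ¬ I.DomainsNonempty) :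
    ¬ I.Yes := by
  rintro ⟨hU, hV, -, -⟩
  exact h ⟨fun u => (hU u).pos, fun v => (hV v).pos⟩

/-! ### Averaged output payoffs -/

/-- The value at `f` of a random homomorphism. -/
noncomputable def image (Ξ : ValuedMinionHom V V') {n : ℕ} (f : V.suppMinion.obj (Fin n)) :
    RatDist (M'.obj (Fin n)) :=
  Ξ.dist.map fun ξ => V'.suppVal (ξ.app (Fin n) f)

open Classical in
/-- The coefficients of the new output payoff of `f` as a linear combination of the old output
payoffs. -/
noncomputable def row (e' : M'.Enumeration) (Ξ : ValuedMinionHom V V') (n : ℕ)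
    (f : M.obj (Fin n)) : Row :=
  if hf : f ∈ V.suppSet (Fin n) then
    some (List.ofFn fun j => (image Ξ (n := n) ⟨f, hf⟩).weight (e' n j))
  else none

/-- The new output payoffs, presented by the fractions that the machine computes. -/
noncomputable def newβ (e' : M'.Enumeration) (Ξ : ValuedMinionHom V V') (I' : VMCInstance V' k)
    (u : Fin I'.nU) (f : M.obj (Fin (I'.domU u))) : Frac :=
  rowFrac (I'.encode e').length (I'.item e' u).β (row e' Ξ (I'.domU u) f)

theorem value_newβ_of_mem (e' : M'.Enumeration) (Ξ : ValuedMinionHom V V') (I' : VMCInstance V' k)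
    (u : Fin I'.nU) (f : M.obj (Fin (I'.domU u))) (hf : f ∈ V.suppSet (Fin (I'.domU u))) :
    (newβ e' Ξ I' u f).value = Ξ.dist.expect fun ξ =>
        (I'.β u (V'.suppVal (ξ.app (Fin (I'.domU u)) ⟨f, hf⟩))).value := by
  rw [newβ, row, dif_pos hf, rowFrac, item, value_sumFrac_ofFn,
    ← RatDist.expect_eq_sum_equiv (image Ξ (n := I'.domU u) ⟨f, hf⟩) (e' (I'.domU u))
      (fun g => (I'.β u g).value)]
  exact RatDist.expect_map _ _ _

theorem value_newβ_of_notMem (e' : M'.Enumeration) (Ξ : ValuedMinionHom V V')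
    (I' : VMCInstance V' k) (u : Fin I'.nU) (f : M.obj (Fin (I'.domU u)))
    (hf : f ∉ V.suppSet (Fin (I'.domU u))) :
    (newβ e' Ξ I' u f).value = -2 ^ (I'.encode e').length := by
  rw [newβ, row, dif_neg hf, rowFrac, value_negPow]

/-- The new expected output payoff of a family of weightings is the old one of its image under
`Ξ`. -/
theorem payoffCondition_newβ (e' : M'.Enumeration) (Ξ : ValuedMinionHom V V')
    (I' : VMCInstance V' k) : PayoffCondition V I'.toVMCData (newβ e' Ξ I') := by
  intro Ω hΩ hin
  refine (I'.payoff _ (Ξ.preserves _ Ω hΩ) hin).trans_eq (Finset.sum_congr rfl fun u _ => ?_)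
  have hs := V.supp_subset_suppSet hΩ u
  change RatDist.expect (Ξ.dist.bind _) _ = _
  rw [RatDist.expect_bind, ← RatDist.expect_restrict _ _ hs]
  calc _ = Ξ.dist.expect fun ξ => ((Ω u).out.restrict (V.suppSet (Fin (I'.domU u))) hs).expect
          fun f => (I'.β u (V'.suppVal (ξ.app (Fin (I'.domU u)) f))).value :=
        congrArg Ξ.dist.expect (funext fun ξ => RatDist.expect_map _
          (fun f => V'.suppVal (ξ.app (Fin (I'.domU u)) f)) fun g => (I'.β u g).value)
    _ = _ := RatDist.expect_comm _ _ _
    _ = _ := congrArg (RatDist.expect _)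
        (funext fun f => (value_newβ_of_mem e' Ξ I' u f.1 f.2).symm)

open Classical in
/-- The reduction: inputs with an empty domain are mapped to a fixed input. -/
noncomputable def reduce (e' : M'.Enumeration) (Ξ : ValuedMinionHom V V') (hk : 0 < k)
    (I' : VMCInstance V' k) : VMCInstance V k :=
  if I'.DomainsNonempty then
    { toVMCData := I'.toVMCData, β := newβ e' Ξ I', payoff := payoffCondition_newβ e' Ξ I' }
  else noInstance V hk

theorem replacesOutputPayoffs_reduce (e' : M'.Enumeration) (Ξ : ValuedMinionHom V V') (hk : 0 < k)
    (I' : VMCInstance V' k) (h : I'.DomainsNonempty) :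
    ReplacesOutputPayoffs Ξ I' (reduce e' Ξ hk I') :=
  ⟨newβ e' Ξ I', payoffCondition_newβ e' Ξ I', 2 ^ (I'.encode e').length, if_pos h,
    by positivity, fun u g => mul_value_lt e' I' u g, value_newβ_of_mem e' Ξ I',
    value_newβ_of_notMem e' Ξ I'⟩

theorem yes_reduce (e' : M'.Enumeration) (Ξ : ValuedMinionHom V V') (hk : 0 < k)
    (I' : VMCInstance V' k) (h : I'.Yes) : (reduce e' Ξ hk I').Yes := by
  have hd : I'.DomainsNonempty := by
    by_contra hd
    exact not_yes_of_not_domainsNonempty hd h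
  rw [reduce, if_pos hd]
  exact h

/-- Replacing the output payoffs preserves `No`. -/
theorem no_of_replacesOutputPayoffs (hV : V'.Nontrivial) {Ξ : ValuedMinionHom V V'}
    {I' : VMCInstance V' k} {I : VMCInstance V k} (hr : ReplacesOutputPayoffs Ξ I' I)
    (hd : I'.DomainsNonempty) (h : I'.No) : I.No := by
  obtain ⟨β, hβ, P, rfl, hP, hbound, hin, hout⟩ := hr
  rintro ⟨hU, hV', hc, hsum⟩
  change 0 ≤ ∑ u : Fin I'.nU, (β u (hU u)).value at hsum
  have hnU (u : Fin I'.nU) : (0 : ℚ) < I'.nU := by exact_mod_cast u.pos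
  -- a new output payoff is less than `P / |U|`
  have hlt (u f) : (β u f).value < P / I'.nU := by
    rw [lt_div_iff₀' (hnU u)]
    by_cases hf : f ∈ V.suppSet (Fin (I'.domU u))
    · rw [hin u f hf]
      obtain ⟨ξ, -, hξ⟩ := RatDist.exists_expect_le Ξ.dist fun ξ =>
        (I'.β u (V'.suppVal (ξ.app (Fin (I'.domU u)) ⟨f, hf⟩))).value
      exact (mul_le_mul_of_nonneg_left hξ (hnU u).le).trans_lt (hbound u _)
    · rw [hout u f hf]
      have := mul_pos (hnU u) hP
      linarith
  -- hence all chosen elements lie in the support minion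
  have hmem (u) : hU u ∈ V.suppSet (Fin (I'.domU u)) := by
    by_contra hu
    have h1 := Finset.add_sum_erase Finset.univ (fun u => (β u (hU u)).value) (Finset.mem_univ u)
    have h2 : ∑ v ∈ Finset.univ.erase u, (β v (hU v)).value ≤
        ∑ v ∈ Finset.univ.erase u, P / I'.nU := Finset.sum_le_sum fun v _ => (hlt v _).le
    have h3 := Finset.add_sum_erase Finset.univ (fun _ : Fin I'.nU => P / I'.nU) (Finset.mem_univ u)
    have h4 : ∑ _v : Fin I'.nU, P / I'.nU = P := by
      rw [Finset.sum_const, Finset.card_univ, Fintype.card_fin, nsmul_eq_mul]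
      exact mul_div_cancel₀ P (hnU u).ne'
    have h5 := div_pos hP (hnU u)
    simp only [hout u _ hu] at h1
    linarith
  simp only [fun u => hin u _ (hmem u)] at hsum
  rw [← RatDist.expect_sum] at hsum
  obtain ⟨ξ, -, hξ⟩ := RatDist.exists_expect_le Ξ.dist fun ξ =>
    ∑ u, (I'.β u (V'.suppVal (ξ.app (Fin (I'.domU u)) ⟨hU u, hmem u⟩))).value
  -- variables in `V` that are not constrained get arbitrary values
  have hne (v) : Nonempty (M'.obj (Fin (I'.domV v))) := by
    have : NeZero (I'.domV v) := ⟨(hd.2 v).ne'⟩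
    obtain ⟨Ω, -⟩ := hV (Fin (I'.domV v))
    exact ⟨Ω.out.supp_nonempty.some⟩
  classical
  refine h ⟨fun u => V'.suppVal (ξ.app (Fin (I'.domU u)) ⟨hU u, hmem u⟩), fun v =>
    if hv : hV' v ∈ V.suppSet (Fin (I'.domV v)) then V'.suppVal (ξ.app (Fin (I'.domV v)) ⟨hV' v, hv⟩)
    else (hne v).some, fun c hcm => ?_, hsum.trans hξ⟩
  have hcc : M.map c.π (hU c.u) = hV' c.v := hc c hcm
  -- a minor of an element of the support minion lies in the support minion
  have hv : hV' c.v ∈ V.suppSet (Fin (I'.domV c.v)) := by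
    rw [← hcc]
    exact V.map_mem_suppSet c.π (hmem c.u)
  have happ := congrArg V'.suppVal (ξ.app_map c.π ⟨hU c.u, hmem c.u⟩)
  have hsub : V.suppMinion.map c.π ⟨hU c.u, hmem c.u⟩ = ⟨hV' c.v, hv⟩ := Subtype.ext hcc
  refine happ.symm.trans (Eq.trans ?_ (dif_pos hv).symm)
  exact congrArg (fun g => V'.suppVal (ξ.app (Fin (I'.domV c.v)) g)) hsub

theorem no_reduce (hV : V'.Nontrivial) (e' : M'.Enumeration) (Ξ : ValuedMinionHom V V')
    (hk : 0 < k) (I' : VMCInstance V' k) (h : I'.No) : (reduce e' Ξ hk I').No := by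
  by_cases hd : I'.DomainsNonempty
  · exact no_of_replacesOutputPayoffs hV (replacesOutputPayoffs_reduce e' Ξ hk I' hd) hd h
  · rw [reduce, if_neg hd]
    exact no_noInstance V hk

/-! ### Computing the reduction -/

/-- The linear maps that compute the tables of the new output payoffs. -/
noncomputable def rows (e : M.Enumeration) (e' : M'.Enumeration) (Ξ : ValuedMinionHom V V')
    (n : ℕ) : List Row :=
  List.ofFn fun i => row e' Ξ n (e n i)

theorem length_of_mem_rows (e : M.Enumeration) (e' : M'.Enumeration) (Ξ : ValuedMinionHom V V')
    (n : ℕ) (ws : List ℚ≥0) (h : some ws ∈ rows e e' Ξ n) :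
    ws.length = Nat.card (M'.obj (Fin n)) := by
  obtain ⟨i, hi⟩ := List.mem_ofFn.mp h
  unfold row at hi
  split_ifs at hi
  simp [← Option.some.inj hi]

open Classical in
/-- The reduction on encodings is the transformation of words that the program performs. -/
theorem encode_reduce (e : M.Enumeration) (e' : M'.Enumeration) (Ξ : ValuedMinionHom V V')
    (hk : 0 < k) (I' : VMCInstance V' k) :
    (reduce e' Ξ hk I').encode e =
      if 0 ∈ ((List.finRange I'.nU).map (I'.item e')).map Item.dom ∨
        0 ∈ (List.finRange I'.nV).map I'.domV then (noInstance V hk).encode e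
      else inputWord (((List.finRange I'.nU).map (I'.item e')).map
        (Item.replace (rows e e' Ξ) (I'.encode e').length))
        ((List.finRange I'.nV).map I'.domV) (condsText I'.toVMCData) := by
  have hiff : (0 ∈ ((List.finRange I'.nU).map (I'.item e')).map Item.dom ∨
      0 ∈ (List.finRange I'.nV).map I'.domV) ↔ ¬ I'.DomainsNonempty := by
    simp [VMCData.DomainsNonempty, item, Nat.pos_iff_ne_zero, imp_iff_not_or]
  by_cases hd : I'.DomainsNonempty
  · rw [if_neg (by rw [hiff]; exact not_not.mpr hd), reduce, if_pos hd, encode_eq]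
    congr 1
    rw [List.map_map]
    refine List.map_congr_left fun u _ => ?_
    simp only [item, Item.replace, Function.comp, rows, List.map_ofFn]
    rfl
  · rw [if_pos (hiff.mpr hd), reduce, if_neg hd]

theorem polyTime_reduce (e : M.Enumeration) (e' : M'.Enumeration) (Ξ : ValuedMinionHom V V')
    (hk : 0 < k) : Nonempty (Turing.TM2ComputableInPolyTime
      (VMCInstance.encode (V := V') (k := k) e') (VMCInstance.encode (V := V) e)
      (reduce e' Ξ hk)) := by
  obtain ⟨C, hC⟩ := within_replaceProg k (fun n => Nat.card (M'.obj (Fin n))) (rows e e' Ξ)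
    ((noInstance V hk).encode e) (length_of_mem_rows e e' Ξ)
  refine polyTime_of_runs (replaceProg k (rows e e' Ξ) ((noInstance V hk).encode e))
    (Polynomial.C C * (Polynomial.X + 1) ^ 3) fun I' => ?_
  obtain ⟨t, ht, hrun⟩ := hC ((List.finRange I'.nU).map (I'.item e'))
    ((List.finRange I'.nV).map I'.domV) (condsText I'.toVMCData) (I'.encode e').length
    (by
      intro x hx
      obtain ⟨u, -, rfl⟩ := List.mem_map.mp hx
      exact ⟨I'.domU_le u, by simp [item]⟩) (by rw [encode_eq])
  refine ⟨t, by simpa using ht, ?_⟩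
  rw [encode_reduce]
  convert hrun using 2
  rw [encode_eq]

end VMCInstance

theorem mainTheorem11 {M M' : Minion} (V : ValuedMinion M) (V' : ValuedMinion M')
    (hV : V.Nontrivial) (hV' : V'.Nontrivial)
    (hfin : V.LocallyFinite) (hfin' : V'.LocallyFinite)
    (e : M.Enumeration) (e' : M'.Enumeration)
    (Ξ : ValuedMinionHom V V') (k : ℕ) (hk : 0 < k) :
    ∃ r : (VMC V' k e').Instance → (VMC V k e).Instance,
      IsPolyTimeReduction (VMC V' k e') (VMC V k e) r ∧
      ∀ I' : VMCInstance V' k, I'.DomainsNonempty → ReplacesOutputPayoffs Ξ I' (r I') :=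
  ⟨VMCInstance.reduce e' Ξ hk, ⟨VMCInstance.polyTime_reduce e e' Ξ hk,
    VMCInstance.yes_reduce e' Ξ hk, VMCInstance.no_reduce hV' e' Ξ hk⟩,
    VMCInstance.replacesOutputPayoffs_reduce e' Ξ hk⟩
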